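/- For $z=x+iy\in\mathbb{C}$ put $F(z)=-3(x^2+y^2+1)^2+8(x^3-3xy^2)+4$, let $\Omega=\{z: F(z)\ge 0\}$ be the closed region bounded by the deltoid (Steiner's hypocycloid) $F=0$, and for $a=\pm\frac12$ let $w_a=F^{a}/\int_\Omega F^a\,dx\,dy$ and $$\langle P,Q\rangle_a=\int_\Omega P(z,\bar z)\,\overline{Q(z,\bar z)}\,w_a(z)\,dx\,dy$$ for polynomials $P,Q$ in $z,\bar z$ with complex coefficients. Let $\Pi_n^2$ be the space of such polynomials of total degree at most $n$ (so $\dim\Pi_{n-1}^2=\binom{n+1}{2}$) and $\mathcal V_n(w_a)=\{P\in\Pi_n^2:\langle P,Q\rangle_a=0 \text{ for all } Q\in\Pi_{n-1}^2\}$. The Chebyshev polynomials on the deltoid, $T_k^n$ (first kind) and $U_k^n$ (second kind), $0\le k\le n$, are defined by $$P_k^{n+1}=3z\,P_k^n-P_{k+1}^n-P_{k-1}^{n-1},\qquad 0\le k\le n,\ n\ge 1,$$ together with $P_{n+1}^{n+1}(z,\bar z)=\overline{P_0^{n+1}(z,\bar z)}$, where $P=T$ or $P=U$, with $T_0^0=1$,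 $T_0^1=z$, $T_1^1=\bar z$, $T_{-1}^n:=T_1^{n+1}$, $T_{n+1}^n:=T_n^{n+1}$, and $U_0^0=1$, $U_0^1=3z$, $U_1^1=3\bar z$, $U_{-1}^n:=0$, $U_{n+1}^n:=0$. Let $\mathbb T_n$ be the column vector of the polynomials $T_k^n$, $0\le k\le n$, normalized to norm one for $\langle\cdot,\cdot\rangle_{-1/2}$, and $\mathbb U_n$ that of the $U_k^n$ normalized for $\langle\cdot,\cdot\rangle_{1/2}$. Let $J_n$ be the $n\times n$ backward identity and $M^\vee=J_n\overline{M}J_m$ for an $n\times m$ matrix $M$. The three-term relation for vectors $\mathbb Q_n$ of $n+1$ polynomials is $$z\,\mathbb Q_n=\alpha_n\mathbb Q_{n+1}+\beta_n\mathbb Q_n+(\alpha_{n-1}^*)^\vee\,\mathbb Q_{n-1},\qquad n\ge0,\quad \mathbb Q_{-1}=0,$$ with complex matrices $\alpha_n$ of size $(n+1)\times(n+2)$ and $\beta_n$ of size $(n+1)\times(n+1)$. For $n\ge1$, consider the condition $$\alpha_{n-1}\alpha_{n-1}^*J_n=(\alpha_{n-1}\alpha_{n-1}^*J_n)^{\mathsf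 t}.\tag{$*$}$$ A common zero of $\mathbb Q_n$ is a $z\in\mathbb C$ at which all components of $\mathbb Q_n$ vanish. Then: 1. For every $n\ge 0$, $\mathbb U_n$ is an orthonormal basis of $\mathcal V_n(w_{1/2})$ whose components $Q_{k,n}$ satisfy $Q_{k,n}=\overline{Q_{n-k,n}}$. The $\mathbb U_n$ satisfy a three-term relation as above; in any such relation the matrices $\alpha_{n-1}$ satisfy $(*)$ for every $n\ge1$; and for every $n\ge1$ the polynomials in $\mathbb U_n$ have the maximal number of common zeros, exactly $\dim\Pi_{n-1}^2$. 2. For every $n\ge 0$, $\mathbb T_n$ is an orthonormal basis of $\mathcal V_n(w_{-1/2})$ with the same conjugation property. The $\mathbb T_n$ satisfy a three-term relation as above; in any such relation $(*)$ fails for every $n\ge2$; and for every $n\ge2$ the polynomials in $\mathbb T_n$ do not have the maximal number of common zeros: they have fewer than $\dim\Pi_{n-1}^2$. -/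

import Mathlib

open MvPolynomial MeasureTheory Matrix

noncomputable section

namespace DeltoidChebyshev

/-- Polynomials in the two variables `z` and `z̄` with complex coefficients:
`X 0` stands for `z` and `X 1` for `z̄`. -/
abbrev CPoly : Type := MvPolynomial (Fin 2) ℂ

/-- The value `P(z, z̄)`. -/
def evalAt (z : ℂ) (P : CPoly) : ℂ :=
  MvPolynomial.eval ![z, (starRingEnd ℂ) z] P

/-- The polynomial whose value at `(z, z̄)` is the complex conjugate of `P(z, z̄)`:
conjugate the coefficients and exchange `z` and `z̄`. -/
def conjPoly (P : CPoly) : CPoly :=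
  rename (Equiv.swap (0 : Fin 2) 1) (MvPolynomial.map (starRingEnd ℂ) P)

/-- The polynomials of total degree `< n` (the zero space for `n = 0`). -/
def polyLT (n : ℕ) : Submodule ℂ CPoly :=
  restrictSupport ℂ {s : Fin 2 →₀ ℕ | s.degree < n}

/-! ### The deltoid and its weights -/

/-- `-3 (x² + y² + 1)² + 8 (x³ - 3 x y²) + 4` at `z = x + i y`. -/
def deltoidFun (z : ℂ) : ℝ :=
  -3 * (z.re ^ 2 + z.im ^ 2 + 1) ^ 2 + 8 * (z.re ^ 3 - 3 * z.re * z.im ^ 2) + 4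

/-- The closed region bounded by Steiner's hypocycloid `deltoidFun z = 0`. -/
def deltoid : Set ℂ := {z | 0 ≤ deltoidFun z}

/-- The weight `w_a = deltoidFun ^ a` (before normalization). -/
def weight (a : ℝ) (z : ℂ) : ℝ := deltoidFun z ^ a

/-- The inner product `⟨P, Q⟩ = ∫ P(z, z̄) conj(Q(z, z̄)) w(z) dx dy` over the deltoid, for the
weight `w = w_a / ∫ w_a` of total mass one. -/
def innerW (a : ℝ) (P Q : CPoly) : ℂ :=
  (∫ z in deltoid, evalAt z P * (starRingEnd ℂ) (evalAt z Q) * (weight a z : ℂ)) /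
    ((∫ z in deltoid, weight a z : ℝ) : ℂ)

/-- The space of orthogonal polynomials of degree `n` for `w_a`: polynomials of degree at most `n`
that are orthogonal to all polynomials of lower degree. -/
def orthSpace (a : ℝ) (n : ℕ) : Set CPoly :=
  {P | P ∈ polyLT (n + 1) ∧ ∀ Q ∈ polyLT n, innerW a P Q = 0}

/-- `Q` is an orthonormal basis of the space of orthogonal polynomials of degree `n` for `w_a`,
and `Q_k(z, z̄)` is the conjugate of `Q_{n-k}(z, z̄)`. -/
structure IsOrthonormalBasis (a : ℝ) (n : ℕ) (Q : Fin (n + 1) → CPoly) : Prop where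
  orthonormal : ∀ j k, innerW a (Q j) (Q k) = if j = k then 1 else 0
  span_eq : (Submodule.span ℂ (Set.range Q) : Set CPoly) = orthSpace a n
  conj_symm : ∀ k, Q k = conjPoly (Q k.rev)

/-! ### The Chebyshev polynomials -/

/-- `chebT n k` is the Chebyshev polynomial of the first kind `T_k^n`, `0 ≤ k ≤ n`
(the value for `k > n` is irrelevant and set to `0`). It is given by
`T_k^{m+1} = 3 z T_k^m - T_{k+1}^m - T_{k-1}^{m-1}` for `0 ≤ k ≤ m`, `m ≥ 1`, where
`T_{-1}^{m-1} = T_1^m` (used for `k = 0`) and `T_{m+1}^m = T_m^{m+1}` (for `k = m`, so that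
`2 T_m^{m+1} = 3 z T_m^m - T_{m-1}^{m-1}`), and `T_{m+1}^{m+1}` is the conjugate of
`T_0^{m+1}`. Below, `m = n + 1`. -/
def chebT : ℕ → ℕ → CPoly
  | 0, k => if k = 0 then 1 else 0
  | 1, k => if k = 0 then X 0 else if k = 1 then X 1 else 0
  | n + 2, k =>
    if k = 0 then 3 * X 0 * chebT (n + 1) 0 - chebT (n + 1) 1 - chebT (n + 1) 1
    else if k ≤ n then
      3 * X 0 * chebT (n + 1) k - chebT (n + 1) (k + 1) - chebT n (k - 1)
    else if k = n + 1 then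
      C (1 / 2) * (3 * X 0 * chebT (n + 1) (n + 1) - chebT n n)
    else if k = n + 2 then
      conjPoly (3 * X 0 * chebT (n + 1) 0 - chebT (n + 1) 1 - chebT (n + 1) 1)
    else 0

/-- `chebU n k` is the Chebyshev polynomial of the second kind `U_k^n`, `0 ≤ k ≤ n`
(and `0` for `k > n`). It is given by
`U_k^{m+1} = 3 z U_k^m - U_{k+1}^m - U_{k-1}^{m-1}` for `0 ≤ k ≤ m`, `m ≥ 1`, where
`U_{-1}^{m-1} = 0` and `U_{m+1}^m = 0`, and `U_{m+1}^{m+1}` is the conjugate of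
`U_0^{m+1}`. Below, `m = n + 1`. -/
def chebU : ℕ → ℕ → CPoly
  | 0, k => if k = 0 then 1 else 0
  | 1, k => if k = 0 then 3 * X 0 else if k = 1 then 3 * X 1 else 0
  | n + 2, k =>
    if k = 0 then 3 * X 0 * chebU (n + 1) 0 - chebU (n + 1) 1
    else if k ≤ n then
      3 * X 0 * chebU (n + 1) k - chebU (n + 1) (k + 1) - chebU n (k - 1)
    else if k = n + 1 then
      3 * X 0 * chebU (n + 1) (n + 1) - chebU n n
    else if k = n + 2 then
      conjPoly (3 * X 0 * chebU (n + 1) 0 - chebU (n + 1) 1)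
    else 0

/-- `P / ‖P‖` for the norm of the inner product `innerW a`. -/
def normalize (a : ℝ) (P : CPoly) : CPoly :=
  C (((Real.sqrt (innerW a P P).re)⁻¹ : ℝ) : ℂ) * P

/-- The vector `𝕋_n` of the normalized polynomials `T_k^n`, `0 ≤ k ≤ n`. -/
def vecT (n : ℕ) (k : Fin (n + 1)) : CPoly := normalize (-1 / 2) (chebT n k)

/-- The vector `𝕌_n` of the normalized polynomials `U_k^n`, `0 ≤ k ≤ n`. -/
def vecU (n : ℕ) (k : Fin (n + 1)) : CPoly := normalize (1 / 2) (chebU n k)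

/-! ### Three-term relation, condition on its coefficients, common zeros -/

/-- The backward identity `J_n`. -/
def backId (n : ℕ) : Matrix (Fin n) (Fin n) ℂ :=
  Matrix.of fun i j => if j = i.rev then 1 else 0

/-- `M^∨ = J_n conj(M) J_m`. -/
def vee {n m : ℕ} (M : Matrix (Fin n) (Fin m) ℂ) : Matrix (Fin n) (Fin m) ℂ :=
  backId n * M.map (starRingEnd ℂ) * backId m

/-- The product of a complex matrix and a column vector of polynomials. -/
def mulVecPoly {n m : ℕ} (M : Matrix (Fin n) (Fin m) ℂ) (Q : Fin m → CPoly) : Fin n → CPoly :=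
  M.map C *ᵥ Q

/-- The three-term relation `z ℚ_n = α_n ℚ_{n+1} + β_n ℚ_n + (α_{n-1}^*)^∨ ℚ_{n-1}` for all
`n ≥ 0`, with `ℚ_{-1} = 0`. -/
structure ThreeTerm (Q : (n : ℕ) → Fin (n + 1) → CPoly)
    (α : (n : ℕ) → Matrix (Fin (n + 1)) (Fin (n + 2)) ℂ)
    (β : (n : ℕ) → Matrix (Fin (n + 1)) (Fin (n + 1)) ℂ) : Prop where
  zero : (fun k => X 0 * Q 0 k) = mulVecPoly (α 0) (Q 1) + mulVecPoly (β 0) (Q 0)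
  succ : ∀ n, (fun k => X 0 * Q (n + 1) k) =
    mulVecPoly (α (n + 1)) (Q (n + 2)) + mulVecPoly (β (n + 1)) (Q (n + 1)) +
      mulVecPoly (vee (α n)ᴴ) (Q n)

/-- The condition `A A^* J = (A A^* J)ᵀ`. -/
def MaxZeroCond {n m : ℕ} (A : Matrix (Fin n) (Fin m) ℂ) : Prop :=
  A * Aᴴ * backId n = (A * Aᴴ * backId n)ᵀ

/-- The common zeros `z ∈ ℂ` of a vector of polynomials. -/
def commonZeros {n : ℕ} (Q : Fin n → CPoly) : Set ℂ := {z | ∀ k, evalAt z (Q k) = 0}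

end DeltoidChebyshev

end

namespace DeltoidChebyshev

/-! ### Evaluation on the complexified torus -/

/-! Write 3z = x + y + w with xyw = 1, the trace of a diagonal matrix; for unimodular x, y, w the
point z runs over the deltoid. In these coordinates the recurrences of T and U are the rule for
multiplying sums over the S₃-orbit of a weight (a, b) by x + y + w, and their boundary conventions
are the reflections in the walls of the Weyl chamber. Thus 6 T_k^n is the symmetric orbit sum of
(n-k, k) (`eval_chebT`) and U_k^n is a Weyl character, a quotient of alternating sums
(`eval_chebU`).

The Jacobian J of the parametrization is the Weyl denominator up to a constant, and F = 12 J². So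
F^(-1/2) turns into a constant weight on the torus and F^(1/2) into the squared modulus of the Weyl
denominator (`integral_deltoid`), and both orthogonality relations reduce to that of torus
characters. The squared norms are 1 for U; for T they depend on whether the weight lies on a wall.

Modulo degree at most n, 3z P_k^n equals c P_k^{n+1}. Hence α_n α_n^* is diagonal with entries
(c²/9) N_k^{n+1} / N_k^n, where N denotes the squared norm, and (*) says that this diagonal is a
palindrome. For U it is constantly 1/9. For T (n ≥ 1) the first entry is 1/9 and the last 2/9.

The leading terms of the n+1 polynomials are all the monomials of degree n, so on their common zeros
every polynomial agrees with one of degree less than n; interpolation then bounds the number of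
zeros by the dimension (`encard_zeros_le`), strictly if a nonzero polynomial of degree less than n
vanishes at all of them. For T the polynomial T_{n-1}^{n-1} does so (`encard_commonZeros_vecT_lt`).
For U, roots of unity of order 3(n+2) supply as many zeros as the bound allows
(`encard_commonZeros_vecU`). -/

/-- The point `(z, z̄)` attached to a triple of nonzero numbers (of product one). -/
noncomputable def torusPt (x y z : ℂ) : Fin 2 → ℂ := ![(x + y + z) / 3, (x⁻¹ + y⁻¹ + z⁻¹) / 3]

/-- The character `x ^ a * y ^ (-b)`. -/
noncomputable def torusMono (x y : ℂ) (a b : ℤ) : ℂ := x ^ a * y ^ (-b)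

/-- The orbit sum of a weight, symmetric for `ε = 1` and alternating for `ε = -1`. -/
noncomputable def weylSum (ε x y z : ℂ) (a b : ℤ) : ℂ :=
  torusMono x z a b + torusMono y x a b + torusMono z y a b +
    ε * (torusMono z x a b + torusMono x y a b + torusMono y z a b)

lemma ne_zero_of_prod_eq_one {x y z : ℂ} (h : x * y * z = 1) : x ≠ 0 ∧ y ≠ 0 ∧ z ≠ 0 := by
  refine ⟨?_, ?_, ?_⟩ <;> rintro rfl <;> simp at h

lemma sum_mul_torusMono {x y z : ℂ} (h : x * y * z = 1) (a b : ℤ) :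
    (x + y + z) * torusMono x z a b =
      torusMono x z (a + 1) b + torusMono x z (a - 1) (b + 1) + torusMono x z a (b - 1) := by
  obtain ⟨hx, hy, hz⟩ := ne_zero_of_prod_eq_one h
  have hy' : y = x⁻¹ * z⁻¹ := by
    field_simp
    linear_combination h
  unfold torusMono
  rw [zpow_add₀ hx, zpow_sub₀ hx, show -(b + 1) = -b - 1 by ring, zpow_sub₀ hz,
    show -(b - 1) = -b + 1 by ring, zpow_add₀ hz, hy']
  simp only [zpow_one]
  field_simp

/-- With a = n-k and b = k, the three weights on the right are those of P_k^{n+1}, P_{k+1}^n and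
P_{k-1}^{n-1}: this is the recurrence. -/
lemma sum_mul_weylSum (ε : ℂ) {x y z : ℂ} (h : x * y * z = 1) (a b : ℤ) :
    (x + y + z) * weylSum ε x y z a b =
      weylSum ε x y z (a + 1) b + weylSum ε x y z (a - 1) (b + 1) + weylSum ε x y z a (b - 1) := by
  have h1 := sum_mul_torusMono h a b
  have h2 := sum_mul_torusMono (x := y) (y := z) (z := x) (by linear_combination h) a b
  have h3 := sum_mul_torusMono (x := z) (y := x) (z := y) (by linear_combination h) a b
  have h4 := sum_mul_torusMono (x := z) (y := y) (z := x) (by linear_combination h) a b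
  have h5 := sum_mul_torusMono (x := x) (y := z) (z := y) (by linear_combination h) a b
  have h6 := sum_mul_torusMono (x := y) (y := x) (z := z) (by linear_combination h) a b
  unfold weylSum
  linear_combination h1 + h2 + h3 + ε * (h4 + h5 + h6)

lemma torusMono_reflect_left {x y z : ℂ} (h : x * y * z = 1) (a b : ℤ) :
    torusMono x z (-a) (a + b) = torusMono y z a b := by
  obtain ⟨hx, hy, hz⟩ := ne_zero_of_prod_eq_one h
  have hy' : y = x⁻¹ * z⁻¹ := by
    field_simp
    linear_combination h
  unfold torusMono
  rw [hy', mul_zpow, _root_.inv_zpow', _root_.inv_zpow', neg_add, zpow_add₀ hz]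
  ring

lemma torusMono_reflect_right {x y z : ℂ} (h : x * y * z = 1) (a b : ℤ) :
    torusMono x z (a + b) (-b) = torusMono x y a b := by
  obtain ⟨hx, hy, hz⟩ := ne_zero_of_prod_eq_one h
  have hy' : y = x⁻¹ * z⁻¹ := by
    field_simp
    linear_combination h
  unfold torusMono
  rw [hy', mul_zpow, _root_.inv_zpow', _root_.inv_zpow', neg_neg, zpow_add₀ hx]
  ring

/-- A simple reflection permutes the six characters and exchanges the two parity classes. The two
reflections account for the conventions at the indices -1 and n+1. -/
lemma weylSum_reflect_left {ε : ℂ} (hε : ε * ε = 1) {x y z : ℂ} (h : x * y * z = 1) (a b : ℤ) :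
    weylSum ε x y z (-a) (a + b) = ε * weylSum ε x y z a b := by
  unfold weylSum
  rw [torusMono_reflect_left (x := x) (y := y) (z := z) (by linear_combination h),
    torusMono_reflect_left (x := y) (y := z) (z := x) (by linear_combination h),
    torusMono_reflect_left (x := z) (y := x) (z := y) (by linear_combination h),
    torusMono_reflect_left (x := z) (y := y) (z := x) (by linear_combination h),
    torusMono_reflect_left (x := x) (y := z) (z := y) (by linear_combination h),
    torusMono_reflect_left (x := y) (y := x) (z := z) (by linear_combination h)]
  linear_combination -(torusMono z x a b + torusMono x y a b + torusMono y z a b) * hε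

lemma weylSum_reflect_right {ε : ℂ} (hε : ε * ε = 1) {x y z : ℂ} (h : x * y * z = 1) (a b : ℤ) :
    weylSum ε x y z (a + b) (-b) = ε * weylSum ε x y z a b := by
  unfold weylSum
  rw [torusMono_reflect_right (x := x) (y := y) (z := z) (by linear_combination h),
    torusMono_reflect_right (x := y) (y := z) (z := x) (by linear_combination h),
    torusMono_reflect_right (x := z) (y := x) (z := y) (by linear_combination h),
    torusMono_reflect_right (x := z) (y := y) (z := x) (by linear_combination h),
    torusMono_reflect_right (x := x) (y := z) (z := y) (by linear_combination h),
    torusMono_reflect_right (x := y) (y := x) (z := z) (by linear_combination h)]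
  linear_combination -(torusMono z x a b + torusMono x y a b + torusMono y z a b) * hε

lemma conj_torusMono (x y : ℂ) (a b : ℤ) :
    (starRingEnd ℂ) (torusMono ((starRingEnd ℂ) x)⁻¹ ((starRingEnd ℂ) y)⁻¹ a b) =
      torusMono y x b a := by
  simp only [torusMono, map_mul, map_zpow₀, Complex.conj_conj, _root_.inv_zpow', neg_neg]
  ring

lemma conj_weylSum {ε : ℂ} (hε : ε * ε = 1) (hr : (starRingEnd ℂ) ε = ε) (x y z : ℂ) (a b : ℤ) :
    (starRingEnd ℂ) (weylSum ε ((starRingEnd ℂ) x)⁻¹ ((starRingEnd ℂ) y)⁻¹ ((starRingEnd ℂ) z)⁻¹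
      a b) = ε * weylSum ε x y z b a := by
  simp only [weylSum, map_add, map_mul, conj_torusMono, hr]
  linear_combination -(torusMono z x b a + torusMono x y b a + torusMono y z b a) * hε

lemma eval_conjPoly (v : Fin 2 → ℂ) (P : CPoly) :
    eval v (conjPoly P) =
      (starRingEnd ℂ) (eval ![(starRingEnd ℂ) (v 1), (starRingEnd ℂ) (v 0)] P) := by
  unfold conjPoly
  induction P using MvPolynomial.induction_on with
  | C a => simp
  | add p q hp hq => simp only [map_add, hp, hq]
  | mul_X p i hp =>
    simp only [map_mul, hp, map_X, rename_X, eval_X]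
    congr 1
    fin_cases i <;> simp

lemma evalAt_conjPoly (z : ℂ) (P : CPoly) :
    evalAt z (conjPoly P) = (starRingEnd ℂ) (evalAt z P) := by
  simp [evalAt, eval_conjPoly]

/-- The triple need not be unimodular, so conjugation acts through the involution sending each
coordinate to its conjugate inverse, which fixes unimodular triples. -/
lemma eval_torusPt_conjPoly (x y z : ℂ) (P : CPoly) :
    eval (torusPt x y z) (conjPoly P) = (starRingEnd ℂ) (eval (torusPt ((starRingEnd ℂ) x)⁻¹
      ((starRingEnd ℂ) y)⁻¹ ((starRingEnd ℂ) z)⁻¹) P) := by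
  rw [eval_conjPoly]
  congr 3
  have h3 : (starRingEnd ℂ) (3 : ℂ) = 3 := map_ofNat _ _
  simp [torusPt, h3]

lemma conj_inv_prod {x y z : ℂ} (h : x * y * z = 1) :
    ((starRingEnd ℂ) x)⁻¹ * ((starRingEnd ℂ) y)⁻¹ * ((starRingEnd ℂ) z)⁻¹ = 1 := by
  rw [← mul_inv, ← mul_inv, ← map_mul, ← map_mul, h]
  simp

lemma eval_chebT (n k : ℕ) (hk : k ≤ n) : ∀ {x y z : ℂ}, x * y * z = 1 →
    6 * eval (torusPt x y z) (chebT n k) = weylSum 1 x y z ((n : ℤ) - k) k := by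
  induction n using Nat.strong_induction_on generalizing k with
  | _ n ih =>
  intro x y z h
  match n, ih, hk with
  | 0, ih, hk =>
    obtain rfl : k = 0 := by omega
    simp [chebT, weylSum, torusMono]
    norm_num
  | 1, ih, hk =>
    obtain ⟨hx, hy, hz⟩ := ne_zero_of_prod_eq_one h
    obtain rfl | rfl : k = 0 ∨ k = 1 := by omega
    · simp [chebT, weylSum, torusMono, torusPt]
      ring
    · simp [chebT, weylSum, torusMono, torusPt]
      ring
  | n + 2, ih, hk =>
    have e0 : eval (torusPt x y z) (X 0) = (x + y + z) / 3 := by simp [torusPt]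
    have key0 : ∀ {x y z : ℂ}, x * y * z = 1 →
        6 * eval (torusPt x y z) (3 * X 0 * chebT (n + 1) 0 - chebT (n + 1) 1 - chebT (n + 1) 1) =
        weylSum 1 x y z (n + 2) 0 := by
      intro x y z h
      have e0 : eval (torusPt x y z) (X 0) = (x + y + z) / 3 := by simp [torusPt]
      have h0 := ih (n + 1) (by omega) 0 (by omega) h
      have h1 := ih (n + 1) (by omega) 1 (by omega) h
      have hr := sum_mul_weylSum 1 h (n + 1) 0
      -- The out-of-range weight (n+1, -1) reflects to (n, 1), hence the two copies of T_1^{n+1}.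
      have hf := weylSum_reflect_right (ε := 1) (by norm_num) h n 1
      push_cast at h0 h1
      simp only [map_sub, map_mul, e0, map_ofNat]
      simp only [sub_zero, add_sub_cancel_right, zero_add, zero_sub, one_mul] at h0 h1 hr hf
      rw [hf, show (n : ℤ) + 1 + 1 = n + 2 by ring] at hr
      linear_combination (x + y + z) * h0 - 2 * h1 + hr
    by_cases k0 : k = 0
    · subst k0
      have := key0 h
      rw [chebT, if_pos rfl, this]
      simp
    by_cases k1 : k ≤ n
    · rw [chebT, if_neg k0, if_pos k1]
      have h0 := ih (n + 1) (by omega) k (by omega) h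
      have h1 := ih (n + 1) (by omega) (k + 1) (by omega) h
      have h2 := ih n (by omega) (k - 1) (by omega) h
      have hr := sum_mul_weylSum 1 h (n + 1 - k) k
      push_cast [Nat.cast_sub (show 1 ≤ k by omega)] at h0 h1 h2 ⊢
      simp only [map_sub, map_mul, e0, map_ofNat]
      rw [show (n : ℤ) + 1 - k + 1 = n + 2 - k by ring,
        show (n : ℤ) + 1 - k - 1 = n + 1 - (k + 1) by ring] at hr
      rw [show (n : ℤ) - (k - 1) = n + 1 - k by ring] at h2
      linear_combination (x + y + z) * h0 - h1 - h2 + hr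
    by_cases k2 : k = n + 1
    · subst k2
      rw [chebT, if_neg k0, if_neg k1, if_pos rfl]
      have h0 := ih (n + 1) (by omega) (n + 1) (by omega) h
      have h2 := ih n (by omega) n (by omega) h
      have hr := sum_mul_weylSum 1 h 0 (n + 1)
      -- The weight (-1, n+2) reflects to (1, n+1), which therefore occurs twice; this is the origin
      -- of the factor 1/2 in the recurrence.
      have hf := weylSum_reflect_left (ε := 1) (by norm_num) h 1 (n + 1)
      push_cast at h0 h2 ⊢
      simp only [map_sub, map_mul, e0, map_ofNat, eval_C]
      simp only [sub_self, zero_add, zero_sub, one_mul, add_sub_cancel_right] at h0 h2 hr hf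
      rw [show (1 : ℤ) + (n + 1) = n + 1 + 1 by ring] at hf
      rw [hf] at hr
      rw [show (n : ℤ) + 2 - (n + 1) = 1 by ring]
      linear_combination (x + y + z) / 2 * h0 - h2 / 2 + hr / 2
    · obtain rfl : k = n + 2 := by omega
      rw [chebT, if_neg k0, if_neg k1, if_neg k2, if_pos rfl, eval_torusPt_conjPoly]
      have := congrArg (starRingEnd ℂ) (key0 (conj_inv_prod h))
      rw [conj_weylSum (by norm_num) (by simp), map_mul, map_ofNat] at this
      rw [this]
      simp

/-- Weyl's character formula. The shift by (1, 1) sends the indices -1 and n+1 to weights on the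
walls, where alternating sums vanish, in accordance with the zero conventions for U. -/
lemma eval_chebU (n k : ℕ) (hk : k ≤ n) : ∀ {x y z : ℂ}, x * y * z = 1 →
    weylSum (-1) x y z 1 1 * eval (torusPt x y z) (chebU n k) =
      weylSum (-1) x y z ((n : ℤ) - k + 1) (k + 1) := by
  induction n using Nat.strong_induction_on generalizing k with
  | _ n ih =>
  intro x y z h
  have w0 : ∀ {x y z : ℂ}, x * y * z = 1 → ∀ a, weylSum (-1) x y z a 0 = 0 := by
    intro x y z h a
    simp [weylSum, torusMono]
    ring
  have w0' : ∀ {x y z : ℂ}, x * y * z = 1 → ∀ a, weylSum (-1) x y z 0 a = 0 := by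
    intro x y z h a
    simp [weylSum, torusMono]
    ring
  match n, ih, hk with
  | 0, ih, hk =>
    obtain rfl : k = 0 := by omega
    simp [chebU]
  | 1, ih, hk =>
    have key : ∀ {x y z : ℂ}, x * y * z = 1 →
        weylSum (-1) x y z 1 1 * (x + y + z) = weylSum (-1) x y z 2 1 := by
      intro x y z h
      have hr := sum_mul_weylSum (-1) h 1 1
      norm_num [w0 h, w0' h] at hr
      linear_combination hr
    obtain rfl | rfl : k = 0 ∨ k = 1 := by omega
    · have := key h
      simp [chebU, torusPt]
      rw [← this]
      ring
    · have := congrArg (starRingEnd ℂ) (key (conj_inv_prod h))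
      rw [conj_weylSum (by norm_num) (by simp), map_mul, conj_weylSum (by norm_num) (by simp)]
        at this
      simp at this
      simp [chebU, torusPt]
      rw [← this]
      ring
  | n + 2, ih, hk =>
    have e0 : eval (torusPt x y z) (X 0) = (x + y + z) / 3 := by simp [torusPt]
    have key0 : ∀ {x y z : ℂ}, x * y * z = 1 → weylSum (-1) x y z 1 1 *
        eval (torusPt x y z) (3 * X 0 * chebU (n + 1) 0 - chebU (n + 1) 1) =
        weylSum (-1) x y z (n + 3) 1 := by
      intro x y z h
      have e0 : eval (torusPt x y z) (X 0) = (x + y + z) / 3 := by simp [torusPt]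
      have h0 := ih (n + 1) (by omega) 0 (by omega) h
      have h1 := ih (n + 1) (by omega) 1 (by omega) h
      have hr := sum_mul_weylSum (-1) h (n + 2) 1
      push_cast at h0 h1
      simp only [map_sub, map_mul, e0, map_ofNat]
      rw [sub_self, w0 h, show (n : ℤ) + 2 + 1 = n + 3 by ring,
        show (n : ℤ) + 2 - 1 = n + 1 by ring, show (1 : ℤ) + 1 = 2 by ring] at hr
      rw [show (n : ℤ) + 1 - 0 + 1 = n + 2 by ring] at h0
      rw [show (n : ℤ) + 1 - 1 + 1 = n + 1 by ring] at h1
      linear_combination (x + y + z) * h0 - h1 + hr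
    by_cases k0 : k = 0
    · subst k0
      have := key0 h
      rw [chebU, if_pos rfl, this]
      push_cast
      rw [show (n : ℤ) + 2 - 0 + 1 = n + 3 by ring]
    by_cases k1 : k ≤ n
    · rw [chebU, if_neg k0, if_pos k1]
      have h0 := ih (n + 1) (by omega) k (by omega) h
      have h1 := ih (n + 1) (by omega) (k + 1) (by omega) h
      have h2 := ih n (by omega) (k - 1) (by omega) h
      have hr := sum_mul_weylSum (-1) h (n + 1 - k + 1) (k + 1)
      push_cast [Nat.cast_sub (show 1 ≤ k by omega)] at h0 h1 h2 ⊢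
      simp only [map_sub, map_mul, e0, map_ofNat]
      rw [show (n : ℤ) + 1 - k + 1 + 1 = n + 2 - k + 1 by ring,
        show (n : ℤ) + 1 - k + 1 - 1 = n + 1 - (k + 1) + 1 by ring, add_sub_cancel_right] at hr
      rw [show (n : ℤ) - (k - 1) = n + 1 - k by ring, sub_add_cancel] at h2
      linear_combination (x + y + z) * h0 - h1 - h2 + hr
    by_cases k2 : k = n + 1
    · subst k2
      rw [chebU, if_neg k0, if_neg k1, if_pos rfl]
      have h0 := ih (n + 1) (by omega) (n + 1) (by omega) h
      have h2 := ih n (by omega) n (by omega) h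
      have hr := sum_mul_weylSum (-1) h 1 (n + 2)
      push_cast at h0 h2 ⊢
      simp only [map_sub, map_mul, e0, map_ofNat]
      rw [sub_self, w0' h, show (1 : ℤ) + 1 = 2 by ring, show (n : ℤ) + 2 - 1 = n + 1 by ring] at hr
      rw [sub_self, zero_add, show (n : ℤ) + 1 + 1 = n + 2 by ring] at h0
      rw [sub_self, zero_add] at h2
      rw [show (n : ℤ) + 2 - (n + 1) + 1 = 2 by ring, show (n : ℤ) + 1 + 1 = n + 2 by ring]
      linear_combination (x + y + z) * h0 - h2 + hr
    · obtain rfl : k = n + 2 := by omega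
      rw [chebU, if_neg k0, if_neg k1, if_neg k2, if_pos rfl, eval_torusPt_conjPoly]
      have := congrArg (starRingEnd ℂ) (key0 (conj_inv_prod h))
      rw [conj_weylSum (by norm_num) (by simp), map_mul, conj_weylSum (by norm_num) (by simp)]
        at this
      push_cast
      rw [sub_self, zero_add, show (n : ℤ) + 2 + 1 = n + 3 by ring]
      linear_combination -this

lemma weylSum_neg_one_one_one {x y z : ℂ} (h : x * y * z = 1) :
    weylSum (-1) x y z 1 1 = (x - y) * (y - z) * (x - z) := by
  obtain ⟨hx, hy, hz⟩ := ne_zero_of_prod_eq_one h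
  have e : ∀ {u v w : ℂ}, u ≠ 0 → u * v * w = 1 → u⁻¹ = v * w := by
    intro u v w hu h
    field_simp
    linear_combination -h
  simp only [weylSum, torusMono, _root_.zpow_neg, zpow_one]
  rw [e hx h, e hy (show y * x * z = 1 by linear_combination h),
    e hz (show z * x * y = 1 by linear_combination h)]
  ring

/-- Every point of `ℂ²` is attached to some triple of product one. -/
lemma exists_torusPt (v : Fin 2 → ℂ) :
    ∃ x y z : ℂ, x * y * z = 1 ∧ torusPt x y z = v := by
  let P : Cubic ℂ := ⟨1, -3 * v 0, 3 * v 1, -1⟩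
  have ha : P.a ≠ 0 := by simp [P]
  obtain ⟨x, y, z, h3⟩ := (Cubic.splits_iff_roots_eq_three (φ := RingHom.id ℂ) ha).1
    (IsAlgClosed.splits _)
  have hb := Cubic.b_eq_three_roots ha h3
  have hc := Cubic.c_eq_three_roots ha h3
  have hd := Cubic.d_eq_three_roots ha h3
  simp [P] at hb hc hd
  have h : x * y * z = 1 := by linear_combination -hd
  obtain ⟨hx, hy, hz⟩ := ne_zero_of_prod_eq_one h
  have e : ∀ {u v w : ℂ}, u ≠ 0 → u * v * w = 1 → u⁻¹ = v * w := by
    intro u v w hu h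
    field_simp
    linear_combination -h
  refine ⟨x, y, z, h, ?_⟩
  ext i
  fin_cases i
  · simp [torusPt]
    linear_combination hb / 3
  · simp only [torusPt]
    rw [e hx h, e hy (show y * x * z = 1 by linear_combination h),
      e hz (show z * x * y = 1 by linear_combination h)]
    simp
    linear_combination -hc / 3

/-- The parametrization is onto ℂ², so identities between polynomials may be checked on orbit sums.
-/
lemma poly_ext_torus {P Q : CPoly} (H : ∀ x y z : ℂ, x * y * z = 1 →
    eval (torusPt x y z) P = eval (torusPt x y z) Q) : P = Q := by
  refine MvPolynomial.funext fun v => ?_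
  obtain ⟨x, y, z, h, rfl⟩ := exists_torusPt v
  exact H x y z h

/-- The discriminant of `t ^ 3 - 3 z t ^ 2 + 3 z̄ t - 1`. -/
noncomputable def discPoly : CPoly :=
  81 * X 0 ^ 2 * X 1 ^ 2 - 108 * X 0 ^ 3 - 108 * X 1 ^ 3 + 162 * X 0 * X 1 - 27

lemma eval_discPoly {x y z : ℂ} (h : x * y * z = 1) :
    eval (torusPt x y z) discPoly = weylSum (-1) x y z 1 1 ^ 2 := by
  obtain ⟨hx, hy, hz⟩ := ne_zero_of_prod_eq_one h
  rw [weylSum_neg_one_one_one h]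
  have hz' : z = x⁻¹ * y⁻¹ := by
    field_simp
    linear_combination h
  simp [torusPt, discPoly]
  subst hz'
  field_simp
  ring

lemma discPoly_ne_zero : discPoly ≠ 0 := by
  intro h
  have := congrArg (eval ![(0 : ℂ), 0]) h
  simp [discPoly] at this

/-- The Weyl denominator is not a polynomial in z and z̄, but its square is `discPoly`, which can be
cancelled. -/
lemma poly_ext_torus_regular {P Q : CPoly} (H : ∀ x y z : ℂ, x * y * z = 1 →
    weylSum (-1) x y z 1 1 * eval (torusPt x y z) P =
      weylSum (-1) x y z 1 1 * eval (torusPt x y z) Q) : P = Q := by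
  refine mul_left_cancel₀ discPoly_ne_zero (poly_ext_torus fun x y z h => ?_)
  rw [map_mul, map_mul, eval_discPoly h]
  linear_combination weylSum (-1) x y z 1 1 * H x y z h

lemma chebT_conj (n k : ℕ) (hk : k ≤ n) : chebT n k = conjPoly (chebT n (n - k)) := by
  refine poly_ext_torus fun x y z h => ?_
  have h1 := eval_chebT n k hk h
  have h2 := congrArg (starRingEnd ℂ) (eval_chebT n (n - k) (by omega) (conj_inv_prod h))
  rw [conj_weylSum (by norm_num) (by simp), map_mul, ← eval_torusPt_conjPoly,
    Nat.cast_sub hk, sub_sub_cancel] at h2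
  simp only [map_ofNat] at h2
  linear_combination h1 / 6 - h2 / 6

lemma chebU_conj (n k : ℕ) (hk : k ≤ n) : chebU n k = conjPoly (chebU n (n - k)) := by
  refine poly_ext_torus_regular fun x y z h => ?_
  have h1 := eval_chebU n k hk h
  have h2 := congrArg (starRingEnd ℂ) (eval_chebU n (n - k) (by omega) (conj_inv_prod h))
  rw [conj_weylSum (by norm_num) (by simp), map_mul, ← eval_torusPt_conjPoly,
    conj_weylSum (by norm_num) (by simp), Nat.cast_sub hk, sub_sub_cancel] at h2
  linear_combination h1 + h2

/-! ### Degrees and leading terms -/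

/-- The monomial `z ^ i * z̄ ^ j`. -/
noncomputable def mon (i j : ℕ) : CPoly := X 0 ^ i * X 1 ^ j

lemma monomial_eq_mon (s : Fin 2 →₀ ℕ) : (monomial s 1 : CPoly) = mon (s 0) (s 1) := by
  rw [monomial_eq, Finsupp.prod_fintype _ _ (by simp), Fin.prod_univ_two]
  simp [mon]

lemma polyLT_eq_span (n : ℕ) :
    polyLT n = Submodule.span ℂ {P | ∃ i j, i + j < n ∧ P = mon i j} := by
  rw [polyLT, restrictSupport_eq_span]
  congr 1
  ext P
  constructor
  · rintro ⟨s, hs, rfl⟩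
    refine ⟨s 0, s 1, ?_, monomial_eq_mon s⟩
    simpa [Finsupp.degree_eq_sum, Fin.sum_univ_two] using hs
  · rintro ⟨i, j, hij, rfl⟩
    refine ⟨Finsupp.single 0 i + Finsupp.single 1 j, ?_, ?_⟩
    · simpa [Finsupp.degree_eq_sum, Fin.sum_univ_two] using hij
    · simp only [monomial_eq_mon]
      simp

lemma mon_mem_polyLT {i j n : ℕ} (h : i + j < n) : mon i j ∈ polyLT n := by
  rw [polyLT_eq_span]
  exact Submodule.subset_span ⟨i, j, h, rfl⟩

lemma polyLT_le {n : ℕ} {W : Submodule ℂ CPoly} (h : ∀ i j, i + j < n → mon i j ∈ W) :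
    polyLT n ≤ W := by
  rw [polyLT_eq_span, Submodule.span_le]
  rintro _ ⟨i, j, hij, rfl⟩
  exact h i j hij

lemma polyLT_mono {m n : ℕ} (h : m ≤ n) : polyLT m ≤ polyLT n :=
  polyLT_le fun _ _ hij => mon_mem_polyLT (by omega)

lemma exists_mem_polyLT (P : CPoly) : ∃ n, P ∈ polyLT n := by
  induction P using MvPolynomial.induction_on' with
  | monomial s a =>
    refine ⟨s 0 + s 1 + 1, ?_⟩
    rw [← mul_one a, ← smul_eq_mul, ← smul_monomial, monomial_eq_mon]
    exact Submodule.smul_mem _ _ (mon_mem_polyLT (by omega))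
  | add p q hp hq =>
    obtain ⟨m, hm⟩ := hp
    obtain ⟨n, hn⟩ := hq
    exact ⟨max m n, add_mem (polyLT_mono (le_max_left _ _) hm) (polyLT_mono (le_max_right _ _) hn)⟩

lemma C_mul_mem {W : Submodule ℂ CPoly} (c : ℂ) {P : CPoly} (h : P ∈ W) : C c * P ∈ W := by
  rw [← smul_eq_C_mul]
  exact W.smul_mem c h

lemma X_mul_mem_polyLT {n : ℕ} {P : CPoly} (h : P ∈ polyLT n) : X 0 * P ∈ polyLT (n + 1) := by
  have : polyLT n ≤ (polyLT (n + 1)).comap (LinearMap.mulLeft ℂ (X 0)) :=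
    polyLT_le fun i j hij => by
      have : X 0 * mon i j = mon (i + 1) j := by
        simp only [mon]
        ring
      simpa [this] using mon_mem_polyLT (show i + 1 + j < n + 1 by omega)
  exact this h

lemma three_eq_C : (3 : CPoly) = C 3 := (map_ofNat C 3).symm

lemma three_X_mul_mem_polyLT {n : ℕ} {P : CPoly} (h : P ∈ polyLT n) :
    3 * X 0 * P ∈ polyLT (n + 1) := by
  rw [mul_assoc, three_eq_C]
  exact C_mul_mem _ (X_mul_mem_polyLT h)

/-- Conjugation of polynomials as a semilinear map. -/
noncomputable def conjLin : CPoly →ₛₗ[starRingEnd ℂ] CPoly where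
  toFun := conjPoly
  map_add' P Q := by simp [conjPoly]
  map_smul' c P := by simp [conjPoly, smul_eq_C_mul]

lemma conjPoly_sub (P Q : CPoly) : conjPoly (P - Q) = conjPoly P - conjPoly Q :=
  map_sub conjLin P Q

lemma conjPoly_C_mul (c : ℂ) (P : CPoly) :
    conjPoly (C c * P) = C ((starRingEnd ℂ) c) * conjPoly P := by
  simp [conjPoly]

lemma conjPoly_mon (i j : ℕ) : conjPoly (mon i j) = mon j i := by
  simp [conjPoly, mon, mul_comm]

lemma conjPoly_mem_polyLT {n : ℕ} {P : CPoly} (h : P ∈ polyLT n) : conjPoly P ∈ polyLT n := by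
  have : polyLT n ≤ (polyLT n).comap conjLin := polyLT_le fun i j hij => by
    change conjPoly (mon i j) ∈ polyLT n
    rw [conjPoly_mon]
    exact mon_mem_polyLT (by omega)
  exact this h

/-- `P` equals a nonzero multiple of `z ^ (n - k) * z̄ ^ k` up to lower degree. -/
def HasLead (P : CPoly) (n k : ℕ) : Prop :=
  ∃ c : ℂ, c ≠ 0 ∧ P - C c * mon (n - k) k ∈ polyLT n

lemma HasLead.mem {P : CPoly} {n k : ℕ} (h : HasLead P n k) (hk : k ≤ n) :
    P ∈ polyLT (n + 1) := by
  obtain ⟨c, -, h⟩ := h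
  rw [← sub_add_cancel P (C c * mon (n - k) k)]
  exact add_mem (polyLT_mono (by omega) h) (C_mul_mem _ (mon_mem_polyLT (by omega)))

lemma HasLead.three_X_mul_sub {P R : CPoly} {n k : ℕ} (h : HasLead P n k) (hk : k ≤ n)
    (hR : R ∈ polyLT (n + 1)) : HasLead (3 * X 0 * P - R) (n + 1) k := by
  obtain ⟨c, hc, h⟩ := h
  refine ⟨3 * c, by simpa using hc, ?_⟩
  have e : 3 * X 0 * P - R - C (3 * c) * mon (n + 1 - k) k =
      3 * X 0 * (P - C c * mon (n - k) k) - R := by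
    rw [show n + 1 - k = n - k + 1 by omega, map_mul, ← three_eq_C]
    simp only [mon]
    ring
  rw [e]
  exact sub_mem (three_X_mul_mem_polyLT h) hR

lemma HasLead.C_mul {P : CPoly} {n k : ℕ} (h : HasLead P n k) {d : ℂ} (hd : d ≠ 0) :
    HasLead (C d * P) n k := by
  obtain ⟨c, hc, h⟩ := h
  refine ⟨d * c, mul_ne_zero hd hc, ?_⟩
  rw [map_mul, mul_assoc, ← mul_sub]
  exact C_mul_mem _ h

lemma HasLead.conjPoly {P : CPoly} {n k : ℕ} (h : HasLead P n k) (hk : k ≤ n) :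
    HasLead (conjPoly P) n (n - k) := by
  obtain ⟨c, hc, h⟩ := h
  refine ⟨(starRingEnd ℂ) c, by simpa using hc, ?_⟩
  have := conjPoly_mem_polyLT h
  rwa [conjPoly_sub, conjPoly_C_mul, conjPoly_mon, show mon k (n - k) = mon (n - (n - k)) (n - k) by
    rw [Nat.sub_sub_self hk]] at this

lemma HasLead.ne_zero {P : CPoly} {n k : ℕ} (h : HasLead P n k) (hk : k ≤ n) : P ≠ 0 := by
  rintro rfl
  obtain ⟨c, hc, h⟩ := h
  have h2 : mon (n - k) k ∈ polyLT n := by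
    have := C_mul_mem (-c⁻¹) h
    rwa [zero_sub, mul_neg, ← mul_assoc, ← map_mul, ← neg_mul, ← map_neg, neg_mul, neg_neg,
      inv_mul_cancel₀ hc, C_1, one_mul] at this
  have e : mon (n - k) k = monomial (Finsupp.single 0 (n - k) + Finsupp.single 1 k) 1 := by
    rw [monomial_eq_mon]
    simp
  rw [e, polyLT, monomial_mem_restrictSupport] at h2
  simp [Finsupp.degree_eq_sum, Fin.sum_univ_two] at h2
  omega

lemma chebT_hasLead (n k : ℕ) (hk : k ≤ n) : HasLead (chebT n k) n k := by
  induction n using Nat.strong_induction_on generalizing k with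
  | _ n ih =>
  match n, ih, hk with
  | 0, ih, hk =>
    obtain rfl : k = 0 := by omega
    exact ⟨1, one_ne_zero, by simp [chebT, mon]⟩
  | 1, ih, hk =>
    obtain rfl | rfl : k = 0 ∨ k = 1 := by omega
    · exact ⟨1, one_ne_zero, by simp [chebT, mon]⟩
    · exact ⟨1, one_ne_zero, by simp [chebT, mon]⟩
  | n + 2, ih, hk =>
    have key0 : HasLead (3 * X 0 * chebT (n + 1) 0 - chebT (n + 1) 1 - chebT (n + 1) 1) (n + 2) 0 := by
      rw [sub_sub]
      have h1 := (ih (n + 1) (by omega) 1 (by omega)).mem (by omega)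
      exact (ih (n + 1) (by omega) 0 (by omega)).three_X_mul_sub (by omega) (add_mem h1 h1)
    by_cases k0 : k = 0
    · subst k0
      rwa [chebT, if_pos rfl]
    by_cases k1 : k ≤ n
    · rw [chebT, if_neg k0, if_pos k1, sub_sub]
      have h1 := (ih (n + 1) (by omega) (k + 1) (by omega)).mem (by omega)
      have h2 := (ih n (by omega) (k - 1) (by omega)).mem (by omega)
      exact (ih (n + 1) (by omega) k (by omega)).three_X_mul_sub (by omega)
        (add_mem h1 (polyLT_mono (by omega) h2))
    by_cases k2 : k = n + 1
    · subst k2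
      rw [chebT, if_neg k0, if_neg k1, if_pos rfl]
      have h2 := (ih n (by omega) n (by omega)).mem (by omega)
      exact ((ih (n + 1) (by omega) (n + 1) (by omega)).three_X_mul_sub (by omega)
        (polyLT_mono (by omega) h2)).C_mul (by norm_num)
    · obtain rfl : k = n + 2 := by omega
      rw [chebT, if_neg k0, if_neg k1, if_neg k2, if_pos rfl]
      exact key0.conjPoly (by omega)

lemma chebU_hasLead (n k : ℕ) (hk : k ≤ n) : HasLead (chebU n k) n k := by
  induction n using Nat.strong_induction_on generalizing k with
  | _ n ih =>
  match n, ih, hk with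
  | 0, ih, hk =>
    obtain rfl : k = 0 := by omega
    exact ⟨1, one_ne_zero, by simp [chebU, mon]⟩
  | 1, ih, hk =>
    obtain rfl | rfl : k = 0 ∨ k = 1 := by omega
    · exact ⟨3, three_ne_zero, by simp [chebU, mon, three_eq_C]⟩
    · exact ⟨3, three_ne_zero, by simp [chebU, mon, three_eq_C]⟩
  | n + 2, ih, hk =>
    have key0 : HasLead (3 * X 0 * chebU (n + 1) 0 - chebU (n + 1) 1) (n + 2) 0 :=
      (ih (n + 1) (by omega) 0 (by omega)).three_X_mul_sub (by omega)
        ((ih (n + 1) (by omega) 1 (by omega)).mem (by omega))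
    by_cases k0 : k = 0
    · subst k0
      rwa [chebU, if_pos rfl]
    by_cases k1 : k ≤ n
    · rw [chebU, if_neg k0, if_pos k1, sub_sub]
      have h1 := (ih (n + 1) (by omega) (k + 1) (by omega)).mem (by omega)
      have h2 := (ih n (by omega) (k - 1) (by omega)).mem (by omega)
      exact (ih (n + 1) (by omega) k (by omega)).three_X_mul_sub (by omega)
        (add_mem h1 (polyLT_mono (by omega) h2))
    by_cases k2 : k = n + 1
    · subst k2
      rw [chebU, if_neg k0, if_neg k1, if_pos rfl]
      have h2 := (ih n (by omega) n (by omega)).mem (by omega)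
      exact (ih (n + 1) (by omega) (n + 1) (by omega)).three_X_mul_sub (by omega)
        (polyLT_mono (by omega) h2)
    · obtain rfl : k = n + 2 := by omega
      rw [chebU, if_neg k0, if_neg k1, if_neg k2, if_pos rfl]
      exact key0.conjPoly (by omega)

/-! ### The parametrization of the deltoid by the torus -/

/-- The point of the torus with angles `p.re`, `p.im` and `-(p.re + p.im)`. -/
noncomputable def torusTriple (p : ℂ) : Fin 3 → ℂ :=
  ![Complex.exp ((p.re : ℝ) * Complex.I), Complex.exp ((p.im : ℝ) * Complex.I),
    Complex.exp ((-(p.re + p.im) : ℝ) * Complex.I)]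

/-- The map from the torus to the deltoid. -/
noncomputable def deltoidMap (p : ℂ) : ℂ :=
  (torusTriple p 0 + torusTriple p 1 + torusTriple p 2) / 3

/-- The Weyl denominator on the torus. -/
noncomputable def weylDenom (p : ℂ) : ℂ :=
  (torusTriple p 0 - torusTriple p 1) * (torusTriple p 1 - torusTriple p 2) *
    (torusTriple p 0 - torusTriple p 2)

lemma norm_torusTriple (p : ℂ) (i : Fin 3) : ‖torusTriple p i‖ = 1 := by
  fin_cases i
  · exact Complex.norm_exp_ofReal_mul_I _
  · exact Complex.norm_exp_ofReal_mul_I _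
  · exact Complex.norm_exp_ofReal_mul_I _

lemma torusTriple_prod (p : ℂ) : torusTriple p 0 * torusTriple p 1 * torusTriple p 2 = 1 := by
  simp only [torusTriple, Matrix.cons_val]
  rw [← Complex.exp_add, ← Complex.exp_add, ← Complex.exp_zero]
  congr 1
  push_cast
  ring

lemma conj_eq_inv {x : ℂ} (hx : ‖x‖ = 1) : (starRingEnd ℂ) x = x⁻¹ :=
  (Complex.inv_eq_conj hx).symm

lemma torusPt_of_norm_eq_one {x y z : ℂ} (hx : ‖x‖ = 1) (hy : ‖y‖ = 1) (hz : ‖z‖ = 1) :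
    torusPt x y z = ![(x + y + z) / 3, (starRingEnd ℂ) ((x + y + z) / 3)] := by
  have h3 : (starRingEnd ℂ) (3 : ℂ) = 3 := map_ofNat _ _
  rw [torusPt, map_div₀, map_add, map_add, conj_eq_inv hx, conj_eq_inv hy, conj_eq_inv hz, h3]

lemma evalAt_eq_eval_torusPt {x y z : ℂ} (hx : ‖x‖ = 1) (hy : ‖y‖ = 1) (hz : ‖z‖ = 1)
    (P : CPoly) : evalAt ((x + y + z) / 3) P = eval (torusPt x y z) P := by
  rw [torusPt_of_norm_eq_one hx hy hz, evalAt]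

lemma evalAt_discPoly (z : ℂ) : evalAt z discPoly = ((-27 * deltoidFun z : ℝ) : ℂ) := by
  have hz : z = z.re + z.im * Complex.I := (Complex.re_add_im z).symm
  have hc : (starRingEnd ℂ) z = z.re - z.im * Complex.I := by
    apply Complex.ext <;> simp
  have hI : Complex.I ^ 2 = -1 := Complex.I_sq
  have hI3 : Complex.I ^ 3 = -Complex.I := Complex.I_pow_three
  have hI4 : Complex.I ^ 4 = 1 := Complex.I_pow_four
  simp only [evalAt, discPoly, map_add, map_sub, map_mul, map_pow, map_ofNat, eval_X,
    Matrix.cons_val_zero, Matrix.cons_val_one]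
  rw [hc]
  generalize z.re = a at *
  generalize z.im = b at *
  rw [hz]
  simp only [deltoidFun]
  push_cast
  simp only [Complex.add_re, Complex.add_im, Complex.mul_re, Complex.mul_im, Complex.ofReal_re,
    Complex.ofReal_im, Complex.I_re, Complex.I_im, mul_zero, mul_one, sub_zero, add_zero, zero_add]
  ring_nf
  simp only [hI, hI4]
  ring

lemma weylDenom_sq (p : ℂ) :
    weylDenom p ^ 2 = ((-27 * deltoidFun (deltoidMap p) : ℝ) : ℂ) := by
  rw [weylDenom, ← weylSum_neg_one_one_one (torusTriple_prod p), ← eval_discPoly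
    (torusTriple_prod p), ← evalAt_eq_eval_torusPt (norm_torusTriple p 0) (norm_torusTriple p 1)
    (norm_torusTriple p 2), evalAt_discPoly]
  rfl

/-- The Jacobian determinant of `deltoidMap`. -/
noncomputable def deltoidJac (p : ℂ) : ℝ :=
  (Complex.I / 3 * (torusTriple p 0 - torusTriple p 2)).re *
      (Complex.I / 3 * (torusTriple p 1 - torusTriple p 2)).im -
    (Complex.I / 3 * (torusTriple p 0 - torusTriple p 2)).im *
      (Complex.I / 3 * (torusTriple p 1 - torusTriple p 2)).re

/-- A real 2×2 determinant is (v̄w - vw̄)/(2i), and conjugation on the torus is inversion; the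
Jacobian thus becomes a rational function of the coordinates. -/
lemma weylDenom_eq (p : ℂ) : weylDenom p = 18 * Complex.I * deltoidJac p := by
  have key : ∀ v w : ℂ, 2 * Complex.I * ((v.re * w.im - v.im * w.re : ℝ) : ℂ) =
      (starRingEnd ℂ) v * w - v * (starRingEnd ℂ) w := by
    intro v w
    apply Complex.ext <;> simp
    ring
  have h := torusTriple_prod p
  obtain ⟨h0, h1, h2⟩ := ne_zero_of_prod_eq_one h
  have h3 : (starRingEnd ℂ) (3 : ℂ) = 3 := map_ofNat _ _
  have hI : Complex.I ^ 2 = -1 := Complex.I_sq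
  rw [show (18 : ℂ) * Complex.I * deltoidJac p = 9 * (2 * Complex.I * deltoidJac p) by ring,
    deltoidJac, key]
  simp only [map_mul, map_div₀, map_sub, Complex.conj_I, conj_eq_inv (norm_torusTriple p _), h3,
    weylDenom]
  generalize torusTriple p 0 = x at *
  generalize torusTriple p 1 = y at *
  generalize torusTriple p 2 = z at *
  have hz : z = x⁻¹ * y⁻¹ := by
    field_simp
    linear_combination h
  subst hz
  field_simp
  rw [hI]
  ring

lemma deltoidFun_deltoidMap (p : ℂ) : deltoidFun (deltoidMap p) = 12 * deltoidJac p ^ 2 := by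
  have h := weylDenom_sq p
  rw [weylDenom_eq] at h
  have h2 : ((-324 * deltoidJac p ^ 2 : ℝ) : ℂ) = ((-27 * deltoidFun (deltoidMap p) : ℝ) : ℂ) := by
    rw [← h]
    push_cast
    linear_combination (-324 * (deltoidJac p : ℂ) ^ 2) * Complex.I_sq
  have h3 := Complex.ofReal_injective h2
  linarith

lemma normSq_weylDenom (p : ℂ) : Complex.normSq (weylDenom p) = 324 * deltoidJac p ^ 2 := by
  rw [weylDenom_eq]
  simp [Complex.normSq_apply]
  ring

lemma hasFDerivAt_deltoidMap (p : ℂ) : HasFDerivAt deltoidMap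
    (Complex.reCLM.smulRight (Complex.I / 3 * (torusTriple p 0 - torusTriple p 2)) +
      Complex.imCLM.smulRight (Complex.I / 3 * (torusTriple p 1 - torusTriple p 2))) p := by
  have hre : HasFDerivAt (fun q : ℂ => ((q.re : ℝ) : ℂ)) (Complex.ofRealCLM.comp Complex.reCLM) p :=
    (Complex.ofRealCLM.comp Complex.reCLM).hasFDerivAt
  have him : HasFDerivAt (fun q : ℂ => ((q.im : ℝ) : ℂ)) (Complex.ofRealCLM.comp Complex.imCLM) p :=
    (Complex.ofRealCLM.comp Complex.imCLM).hasFDerivAt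
  have h0 := (hre.mul_const Complex.I).cexp
  have h1 := (him.mul_const Complex.I).cexp
  have h2 := ((hre.add him).neg.mul_const Complex.I).cexp
  have h := ((h0.add h1).add h2).mul_const (3⁻¹ : ℂ)
  refine (h.congr_of_eventuallyEq (Filter.Eventually.of_forall fun q => ?_)).congr_fderiv ?_
  · simp [deltoidMap, torusTriple, div_eq_mul_inv]
  · ext
    simp [torusTriple]
    ring

lemma det_smulRight (v w : ℂ) :
    (Complex.reCLM.smulRight v + Complex.imCLM.smulRight w : ℂ →L[ℝ] ℂ).det =
      v.re * w.im - v.im * w.re := by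
  rw [ContinuousLinearMap.det, ← LinearMap.det_toMatrix Complex.basisOneI, Matrix.det_fin_two]
  simp [LinearMap.toMatrix_apply]
  ring

/-- A fundamental square for the torus. -/
noncomputable def torusBox : Set ℂ :=
  Set.Ioc (-Real.pi) Real.pi ×ℂ Set.Ioc (-Real.pi) Real.pi

lemma measurableSet_torusBox : MeasurableSet torusBox :=
  (measurableSet_Ioc.preimage Complex.measurable_re).inter
    (measurableSet_Ioc.preimage Complex.measurable_im)

/-- The angles of the three coordinates. -/
noncomputable def angles (p : ℂ) (i : Fin 3) : ℝ := (torusTriple p i).arg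

lemma angles_zero {p : ℂ} (hp : p ∈ torusBox) : angles p 0 = p.re := by
  simp only [angles, torusTriple, Matrix.cons_val]
  rw [Complex.arg_exp_mul_I, toIocMod_eq_self]
  have := hp.1
  simpa [two_mul] using this

lemma angles_one {p : ℂ} (hp : p ∈ torusBox) : angles p 1 = p.im := by
  simp only [angles, torusTriple, Matrix.cons_val]
  rw [Complex.arg_exp_mul_I, toIocMod_eq_self]
  have := hp.2
  simpa [two_mul] using this

lemma continuous_torusTriple (i : Fin 3) : Continuous fun p => torusTriple p i := by
  fin_cases i
  · simp only [torusTriple]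
    dsimp
    fun_prop
  · simp only [torusTriple]
    dsimp
    fun_prop
  · simp only [torusTriple]
    dsimp
    fun_prop

lemma continuous_deltoidMap : Continuous deltoidMap := by
  unfold deltoidMap
  have := continuous_torusTriple
  fun_prop

lemma continuous_weylDenom : Continuous weylDenom := by
  unfold weylDenom
  have := continuous_torusTriple
  fun_prop

/-- The part of the fundamental square where the angles are ordered by `σ`. -/
noncomputable def alcove (σ : Equiv.Perm (Fin 3)) : Set ℂ :=
  torusBox ∩ {p | StrictMono (angles p ∘ σ)}

lemma measurableSet_alcove (σ : Equiv.Perm (Fin 3)) : MeasurableSet (alcove σ) := by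
  refine measurableSet_torusBox.inter ?_
  have : {p | StrictMono (angles p ∘ σ)} =
      ⋂ (i : Fin 3) (j : Fin 3) (_ : i < j), {p | angles p (σ i) < angles p (σ j)} := by
    ext p
    simp [StrictMono]
  rw [this]
  have hm : ∀ i, Measurable fun p => angles p i := fun i =>
    Complex.measurable_arg.comp (continuous_torusTriple i).measurable
  exact MeasurableSet.iInter fun i => MeasurableSet.iInter fun j => MeasurableSet.iInter fun _ =>
    measurableSet_lt (hm _) (hm _)

/-- For unimodular triples of product 1 the second elementary symmetric function is the conjugate of
the first, so equal sums mean that both triples are the roots of one cubic. -/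
lemma exists_eq_of_sum_eq {s t : Fin 3 → ℂ} (hs : ∀ i, ‖s i‖ = 1) (ht : ∀ i, ‖t i‖ = 1)
    (hs1 : s 0 * s 1 * s 2 = 1) (ht1 : t 0 * t 1 * t 2 = 1)
    (h : s 0 + s 1 + s 2 = t 0 + t 1 + t 2) (i : Fin 3) : ∃ j, s i = t j := by
  have h2 := congrArg (starRingEnd ℂ) h
  simp only [map_add, conj_eq_inv (hs _), conj_eq_inv (ht _)] at h2
  obtain ⟨s0, s1, s2⟩ := ne_zero_of_prod_eq_one hs1
  obtain ⟨t0, t1, t2⟩ := ne_zero_of_prod_eq_one ht1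
  have e : ∀ {u v w : ℂ}, u ≠ 0 → u * v * w = 1 → u⁻¹ = v * w := by
    intro u v w hu h
    field_simp
    linear_combination -h
  rw [e s0 hs1, e s1 (show s 1 * s 0 * s 2 = 1 by linear_combination hs1),
    e s2 (show s 2 * s 0 * s 1 = 1 by linear_combination hs1),
    e t0 ht1, e t1 (show t 1 * t 0 * t 2 = 1 by linear_combination ht1),
    e t2 (show t 2 * t 0 * t 1 = 1 by linear_combination ht1)] at h2
  have key : (s i - t 0) * (s i - t 1) * (s i - t 2) = 0 := by
    have : (s i - s 0) * (s i - s 1) * (s i - s 2) = 0 := by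
      fin_cases i <;> simp
    linear_combination this + s i ^ 2 * h - s i * h2 + hs1 - ht1
  rcases mul_eq_zero.1 key with h | h
  · rcases mul_eq_zero.1 h with h | h
    · exact ⟨0, sub_eq_zero.1 h⟩
    · exact ⟨1, sub_eq_zero.1 h⟩
  · exact ⟨2, sub_eq_zero.1 h⟩

lemma range_eq_of_sum_eq {s t : Fin 3 → ℂ} (hs : ∀ i, ‖s i‖ = 1) (ht : ∀ i, ‖t i‖ = 1)
    (hs1 : s 0 * s 1 * s 2 = 1) (ht1 : t 0 * t 1 * t 2 = 1)
    (h : s 0 + s 1 + s 2 = t 0 + t 1 + t 2) : Set.range s = Set.range t := by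
  apply Set.Subset.antisymm
  · rintro _ ⟨i, rfl⟩
    obtain ⟨j, hj⟩ := exists_eq_of_sum_eq hs ht hs1 ht1 h i
    exact ⟨j, hj.symm⟩
  · rintro _ ⟨i, rfl⟩
    obtain ⟨j, hj⟩ := exists_eq_of_sum_eq ht hs ht1 hs1 h.symm i
    exact ⟨j, hj.symm⟩

/-- The image determines the set of angles, and the prescribed order then determines each angle. -/
lemma injOn_deltoidMap (σ : Equiv.Perm (Fin 3)) : Set.InjOn deltoidMap (alcove σ) := by
  rintro p ⟨hp, hp'⟩ q ⟨hq, hq'⟩ h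
  have h' : torusTriple p 0 + torusTriple p 1 + torusTriple p 2 =
      torusTriple q 0 + torusTriple q 1 + torusTriple q 2 := by
    simp only [deltoidMap] at h
    linear_combination 3 * h
  have hr := range_eq_of_sum_eq (norm_torusTriple p) (norm_torusTriple q) (torusTriple_prod p)
    (torusTriple_prod q) h'
  have e : ∀ p, angles p = Complex.arg ∘ torusTriple p := fun p => rfl
  have hr' : Set.range (angles p ∘ σ) = Set.range (angles q ∘ σ) := by
    rw [EquivLike.range_comp, EquivLike.range_comp, e, e, Set.range_comp, Set.range_comp, hr]
  have ha := (hp'.range_inj hq').1 hr'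
  have ha' : angles p = angles q := by
    ext i
    simpa using congrFun ha (σ.symm i)
  apply Complex.ext
  · rw [← angles_zero hp, ← angles_zero hq, ha']
  · rw [← angles_one hp, ← angles_one hq, ha']

/-- The involution s ↦ 1/s̄ exchanges x and y and fixes z, so the Vandermonde product equals its own
conjugate. -/
lemma exists_real_of_conj_inv {x y z : ℂ} (h : x * y * z = 1) (hy : y = ((starRingEnd ℂ) x)⁻¹) :
    ∃ r : ℝ, (x - y) * (y - z) * (x - z) = r := by
  obtain ⟨hx, hy0, hz⟩ := ne_zero_of_prod_eq_one h
  have hx' : (starRingEnd ℂ) x ≠ 0 := by simpa using hx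
  refine ⟨((x - y) * (y - z) * (x - z)).re, ?_⟩
  rw [eq_comm, ← Complex.conj_eq_iff_re]
  have hz' : z = (starRingEnd ℂ) x * x⁻¹ := by
    rw [hy] at h
    field_simp at h ⊢
    linear_combination h
  rw [hz', hy]
  simp only [map_mul, map_sub, map_inv₀, Complex.conj_conj]
  field_simp
  ring

/-- The roots of t³ - 3wt² + 3w̄t - 1 are permuted by s ↦ 1/s̄. Were two of them exchanged or equal,
the discriminant -27F(w) would be the square of a real number, against F(w) > 0. So the roots are
distinct and each is fixed, that is, unimodular. -/
lemma exists_unimodular {w : ℂ} (hw : 0 < deltoidFun w) :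
    ∃ t : Fin 3 → ℂ, (∀ i, ‖t i‖ = 1) ∧ t 0 * t 1 * t 2 = 1 ∧ t 0 + t 1 + t 2 = 3 * w ∧
      Function.Injective t := by
  obtain ⟨x, y, z, h, hv⟩ := exists_torusPt ![w, (starRingEnd ℂ) w]
  have hD := eval_discPoly h
  rw [hv, weylSum_neg_one_one_one h] at hD
  have hD' : ((-27 * deltoidFun w : ℝ) : ℂ) = ((x - y) * (y - z) * (x - z)) ^ 2 := by
    rw [← evalAt_discPoly, ← hD, evalAt]
  have nr : ∀ r : ℝ, ((x - y) * (y - z) * (x - z)) ^ 2 ≠ (r : ℂ) ^ 2 := by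
    intro r hr
    rw [hr] at hD'
    have : -27 * deltoidFun w = r ^ 2 := by exact_mod_cast hD'
    nlinarith [sq_nonneg r]
  obtain ⟨hx, hy, hz⟩ := ne_zero_of_prod_eq_one h
  have e1 := congrFun hv 0
  have e2 := congrFun hv 1
  simp only [torusPt, Matrix.cons_val_zero, Matrix.cons_val_one] at e1 e2
  have e : ∀ {u v w : ℂ}, u ≠ 0 → u * v * w = 1 → u⁻¹ = v * w := by
    intro u v w hu h
    field_simp
    linear_combination -h
  rw [e hx h, e hy (show y * x * z = 1 by linear_combination h),
      e hz (show z * x * y = 1 by linear_combination h)] at e2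
  have root : ∀ s : ℂ, s ≠ 0 → (s - x) * (s - y) * (s - z) = 0 →
      (((starRingEnd ℂ) s)⁻¹ - x) * (((starRingEnd ℂ) s)⁻¹ - y) * (((starRingEnd ℂ) s)⁻¹ - z) = 0 := by
    intro s hs h0
    have hs' : (starRingEnd ℂ) s ≠ 0 := by simpa using hs
    have h1 : s ^ 3 - 3 * w * s ^ 2 + 3 * (starRingEnd ℂ) w * s - 1 = 0 := by
      linear_combination h0 + 3 * s ^ 2 * e1 - 3 * s * e2 + h
    have h3 : (starRingEnd ℂ) (3 : ℂ) = 3 := map_ofNat _ _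
    have h2 := congrArg (starRingEnd ℂ) h1
    simp only [map_sub, map_add, map_mul, map_pow, Complex.conj_conj, h3, map_zero, map_one] at h2
    have h4 : ((starRingEnd ℂ) s)⁻¹ ^ 3 - 3 * w * ((starRingEnd ℂ) s)⁻¹ ^ 2 +
        3 * (starRingEnd ℂ) w * ((starRingEnd ℂ) s)⁻¹ - 1 = 0 := by
      field_simp
      linear_combination -h2
    linear_combination h4 - 3 * ((starRingEnd ℂ) s)⁻¹ ^ 2 * e1 + 3 * ((starRingEnd ℂ) s)⁻¹ * e2 - h
  have hnorm : ∀ s : ℂ, s ≠ 0 → ((starRingEnd ℂ) s)⁻¹ = s → ‖s‖ = 1 := by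
    intro s hs h
    have h1 : s * (starRingEnd ℂ) s = 1 := by
      have hs' : (starRingEnd ℂ) s ≠ 0 := by simpa using hs
      field_simp at h
      linear_combination -h
    rw [Complex.mul_conj, Complex.normSq_eq_norm_sq] at h1
    have h2 : ‖s‖ ^ 2 = 1 := by exact_mod_cast h1
    nlinarith [norm_nonneg s]
  have nxy : x ≠ y := fun he => nr 0 (by rw [he]; simp)
  have nyz : y ≠ z := fun he => nr 0 (by rw [he]; simp)
  have nxz : x ≠ z := fun he => nr 0 (by rw [he]; simp)
  have bad : ∀ a b c : ℂ, a * b * c = 1 → ((a - b) * (b - c) * (a - c)) ^ 2 =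
      ((x - y) * (y - z) * (x - z)) ^ 2 → ((starRingEnd ℂ) a)⁻¹ ≠ b := by
    intro a b c habc hsq hb
    obtain ⟨r, hr⟩ := exists_real_of_conj_inv habc hb.symm
    exact nr r (by rw [← hsq, hr])
  have nx : ‖x‖ = 1 := by
    refine hnorm x hx ?_
    rcases mul_eq_zero.1 (root x hx (by ring)) with h' | h'
    · rcases mul_eq_zero.1 h' with h' | h'
      · exact sub_eq_zero.1 h'
      · exact absurd (sub_eq_zero.1 h') (bad x y z h rfl)
    · exact absurd (sub_eq_zero.1 h') (bad x z y (by linear_combination h) (by ring))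
  have ny : ‖y‖ = 1 := by
    refine hnorm y hy ?_
    rcases mul_eq_zero.1 (root y hy (by ring)) with h' | h'
    · rcases mul_eq_zero.1 h' with h' | h'
      · exact absurd (sub_eq_zero.1 h') (bad y x z (by linear_combination h) (by ring))
      · exact sub_eq_zero.1 h'
    · exact absurd (sub_eq_zero.1 h') (bad y z x (by linear_combination h) (by ring))
  have nz : ‖z‖ = 1 := by
    refine hnorm z hz ?_
    rcases mul_eq_zero.1 (root z hz (by ring)) with h' | h'
    · rcases mul_eq_zero.1 h' with h' | h'
      · exact absurd (sub_eq_zero.1 h') (bad z x y (by linear_combination h) (by ring))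
      · exact absurd (sub_eq_zero.1 h') (bad z y x (by linear_combination h) (by ring))
    · exact sub_eq_zero.1 h'
  refine ⟨![x, y, z], ?_, h, ?_, ?_⟩
  · intro i
    fin_cases i
    exacts [nx, ny, nz]
  · simp only [Matrix.cons_val]
    linear_combination 3 * e1
  · intro i j hij
    fin_cases i <;> fin_cases j <;> simp_all

/-! ### Change of variables -/

lemma torusTriple_injective_iff (p : ℂ) :
    Function.Injective (torusTriple p) ↔ weylDenom p ≠ 0 := by
  rw [weylDenom]
  constructor
  · intro h
    have h01 := h.ne (show (0 : Fin 3) ≠ 1 by decide)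
    have h12 := h.ne (show (1 : Fin 3) ≠ 2 by decide)
    have h02 := h.ne (show (0 : Fin 3) ≠ 2 by decide)
    exact mul_ne_zero (mul_ne_zero (sub_ne_zero.2 h01) (sub_ne_zero.2 h12)) (sub_ne_zero.2 h02)
  · intro h i j hij
    simp only [ne_eq, mul_eq_zero, sub_eq_zero, not_or] at h
    obtain ⟨⟨h01, h12⟩, h02⟩ := h
    fin_cases i <;> fin_cases j <;> simp_all [eq_comm]

lemma deltoidFun_pos_iff (p : ℂ) : 0 < deltoidFun (deltoidMap p) ↔ weylDenom p ≠ 0 := by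
  rw [deltoidFun_deltoidMap, weylDenom_eq]
  simp only [ne_eq, mul_eq_zero, Complex.I_ne_zero, OfNat.ofNat_ne_zero, or_self, false_or,
    Complex.ofReal_eq_zero]
  constructor
  · intro h h0
    simp [h0] at h
  · intro h
    positivity

lemma arg_injOn_unit {x y : ℂ} (hx : ‖x‖ = 1) (hy : ‖y‖ = 1) (h : x.arg = y.arg) : x = y :=
  Complex.ext_norm_arg (hx.trans hy.symm) h

lemma exp_arg_of_norm_one {x : ℂ} (hx : ‖x‖ = 1) : Complex.exp ((x.arg : ℝ) * Complex.I) = x := by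
  have := Complex.norm_mul_exp_arg_mul_I x
  rwa [hx, Complex.ofReal_one, one_mul] at this

lemma torusTriple_of_args {s : Fin 3 → ℂ} (hs : ∀ i, ‖s i‖ = 1) (h : s 0 * s 1 * s 2 = 1) :
    torusTriple ⟨(s 0).arg, (s 1).arg⟩ = s := by
  have h0 := exp_arg_of_norm_one (hs 0)
  have h1 := exp_arg_of_norm_one (hs 1)
  obtain ⟨n0, n1, n2⟩ := ne_zero_of_prod_eq_one h
  ext i
  fin_cases i
  · exact h0
  · exact h1
  · simp only [torusTriple]
    dsimp
    push_cast
    rw [neg_mul, add_mul, neg_add, Complex.exp_add, Complex.exp_neg, Complex.exp_neg, h0, h1]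
    field_simp
    linear_combination -h

lemma alcove_injective {σ : Equiv.Perm (Fin 3)} {p : ℂ} (hp : p ∈ alcove σ) :
    Function.Injective (torusTriple p) := by
  have h : Function.Injective (angles p) := by
    have := hp.2.injective
    rwa [EquivLike.injective_comp] at this
  intro i j hij
  exact h (by simp only [angles, hij])

lemma image_alcove (σ : Equiv.Perm (Fin 3)) :
    deltoidMap '' alcove σ = {z | 0 < deltoidFun z} := by
  ext w
  constructor
  · rintro ⟨p, hp, rfl⟩
    exact (deltoidFun_pos_iff p).2 ((torusTriple_injective_iff p).1 (alcove_injective hp))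
  · intro hw
    obtain ⟨t, ht, hprod, hsum, hinj⟩ := exists_unimodular hw
    have hargs : Function.Injective (Complex.arg ∘ t) := fun i j hij =>
      hinj (arg_injOn_unit (ht i) (ht j) hij)
    -- This relabelling puts the arguments of the three roots in the order prescribed by `σ`.
    let τ : Equiv.Perm (Fin 3) := σ.symm.trans (Tuple.sort (Complex.arg ∘ t))
    have hs1 : (t ∘ τ) 0 * (t ∘ τ) 1 * (t ∘ τ) 2 = 1 := by
      rw [← Fin.prod_univ_three, ← hprod, ← Fin.prod_univ_three]
      exact Equiv.prod_comp τ t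
    have hs2 : (t ∘ τ) 0 + (t ∘ τ) 1 + (t ∘ τ) 2 = 3 * w := by
      rw [← Fin.sum_univ_three, ← hsum, ← Fin.sum_univ_three]
      exact Equiv.sum_comp τ t
    have htr := torusTriple_of_args (s := t ∘ τ) (fun i => ht _) hs1
    refine ⟨⟨((t ∘ τ) 0).arg, ((t ∘ τ) 1).arg⟩, ⟨?_, ?_⟩, ?_⟩
    · exact ⟨Complex.arg_mem_Ioc _, Complex.arg_mem_Ioc _⟩
    · have e : angles ⟨((t ∘ τ) 0).arg, ((t ∘ τ) 1).arg⟩ ∘ σ =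
          (Complex.arg ∘ t) ∘ Tuple.sort (Complex.arg ∘ t) := by
        ext i
        simp only [Function.comp_apply, angles] at htr ⊢
        rw [htr]
        simp [τ]
      rw [Set.mem_ofPred_eq, e]
      exact (Tuple.monotone_sort _).strictMono_of_injective
        (hargs.comp (Equiv.injective _))
    · rw [deltoidMap, htr, hs2]
      field_simp

lemma iUnion_alcove : ⋃ σ, alcove σ = torusBox ∩ {p | weylDenom p ≠ 0} := by
  ext p
  simp only [Set.mem_iUnion]
  constructor
  · rintro ⟨σ, hp⟩
    exact ⟨hp.1, (torusTriple_injective_iff p).1 (alcove_injective hp)⟩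
  · rintro ⟨hp, h⟩
    have hinj := (torusTriple_injective_iff p).2 h
    have ha : Function.Injective (angles p) := fun i j hij =>
      hinj (arg_injOn_unit (norm_torusTriple p i) (norm_torusTriple p j) hij)
    exact ⟨Tuple.sort (angles p), hp, (Tuple.monotone_sort _).strictMono_of_injective
      (ha.comp (Equiv.injective _))⟩

lemma pairwise_disjoint_alcove : Pairwise (Function.onFun Disjoint alcove) := by
  intro σ τ hne
  rw [Function.onFun, Set.disjoint_left]
  intro p hp hq
  apply hne
  have h := (hp.2.range_inj hq.2).1 (by rw [EquivLike.range_comp, EquivLike.range_comp])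
  have ha : Function.Injective (angles p) := by
    have := hp.2.injective
    rwa [EquivLike.injective_comp] at this
  ext i
  exact congrArg _ (ha (congrFun h i))

/-- By Fubini: since b ≠ 0, each vertical line meets the set in countably many points. -/
lemma volume_exp_eq_one (a b : ℝ) (hb : b ≠ 0) :
    volume {p : ℂ | Complex.exp ((a * p.re + b * p.im : ℝ) * Complex.I) = 1} = 0 := by
  have hm : MeasurableSet {q : ℝ × ℝ | Complex.exp ((a * q.1 + b * q.2 : ℝ) * Complex.I) = 1} := by
    refine measurableSet_eq_fun (Continuous.measurable ?_) measurable_const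
    fun_prop
  have : {p : ℂ | Complex.exp ((a * p.re + b * p.im : ℝ) * Complex.I) = 1} =
      Complex.measurableEquivRealProd ⁻¹'
        {q : ℝ × ℝ | Complex.exp ((a * q.1 + b * q.2 : ℝ) * Complex.I) = 1} := by
    ext p
    simp [Complex.measurableEquivRealProd_apply]
  rw [this, Complex.volume_preserving_equiv_real_prod.measure_preimage hm.nullMeasurableSet,
    Measure.volume_eq_prod, Measure.measure_prod_null hm]
  refine Filter.Eventually.of_forall fun x => ?_
  refine Set.Countable.measure_zero ?_ _
  refine (Set.countable_range fun k : ℤ => (2 * Real.pi * k - a * x) / b).mono ?_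
  intro y hy
  obtain ⟨k, hk⟩ := Complex.exp_eq_one_iff.1 hy
  refine ⟨k, ?_⟩
  have h2 : ((a * x + b * y : ℝ) : ℂ) = ((2 * Real.pi * k : ℝ) : ℂ) := by
    apply mul_right_cancel₀ Complex.I_ne_zero
    rw [hk]
    push_cast
    ring
  have h3 := Complex.ofReal_injective h2
  simp only
  field_simp
  linarith

lemma exp_mul_I_eq_iff {x y : ℝ} (h : Complex.exp (x * Complex.I) = Complex.exp (y * Complex.I))
    {u : ℝ} (hu : u = x - y) : Complex.exp (u * Complex.I) = 1 := by
  rw [hu, Complex.ofReal_sub, sub_mul, Complex.exp_sub, h, div_self (Complex.exp_ne_zero _)]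

lemma volume_weylDenom_eq_zero : volume {p : ℂ | weylDenom p = 0} = 0 := by
  refine measure_mono_null ?_ (measure_union_null (volume_exp_eq_one 1 (-1) (by norm_num))
    (measure_union_null (volume_exp_eq_one 1 2 (by norm_num))
      (volume_exp_eq_one 2 1 (by norm_num))))
  intro p hp
  rw [Set.mem_ofPred_eq, weylDenom] at hp
  simp only [mul_eq_zero, sub_eq_zero, torusTriple, Matrix.cons_val] at hp
  rcases hp with (hp | hp) | hp
  · exact Or.inl (exp_mul_I_eq_iff hp (by ring))
  · exact Or.inr (Or.inl (exp_mul_I_eq_iff hp (by ring)))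
  · exact Or.inr (Or.inr (exp_mul_I_eq_iff hp (by ring)))

lemma integrableOn_torusBox {f : ℂ → ℂ} (hf : Continuous f) : IntegrableOn f torusBox := by
  have : torusBox ⊆ Set.Icc (-Real.pi) Real.pi ×ℂ Set.Icc (-Real.pi) Real.pi :=
    fun p hp => ⟨Set.Ioc_subset_Icc_self hp.1, Set.Ioc_subset_Icc_self hp.2⟩
  exact (hf.continuousOn.integrableOn_compact
    (isCompact_Icc.reProdIm isCompact_Icc)).mono_set this

lemma continuous_deltoidFun : Continuous deltoidFun := by
  unfold deltoidFun
  fun_prop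

/-- Change of variables from the deltoid to the torus. -/
lemma integral_deltoid {a κ : ℝ} (ha : a ≠ 0) {ω : ℂ → ℝ} (hω : Continuous ω)
    (h : ∀ p, weylDenom p ≠ 0 → |deltoidJac p| * weight a (deltoidMap p) = κ * ω p)
    {g : ℂ → ℂ} (hg : Continuous g) :
    ∫ z in deltoid, g z * (weight a z : ℂ) =
      (κ / 6 : ℝ) * ∫ p in torusBox, g (deltoidMap p) * (ω p : ℂ) := by
  have hpos : MeasurableSet {z | 0 < deltoidFun z} :=
    measurableSet_lt measurable_const continuous_deltoidFun.measurable
  have hdel : MeasurableSet deltoid :=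
    measurableSet_le measurable_const continuous_deltoidFun.measurable
  have step1 : ∫ z in deltoid, g z * (weight a z : ℂ) =
      ∫ z in {z | 0 < deltoidFun z}, g z * (weight a z : ℂ) := by
    refine setIntegral_eq_of_subset_of_forall_sdiff_eq_zero hdel (fun z hz => le_of_lt (show 0 < deltoidFun z from hz)) ?_
    rintro z ⟨hz, hz'⟩
    have : deltoidFun z = 0 := le_antisymm (not_lt.1 hz') hz
    -- In Lean 0 ^ a = 0 for every a ≠ 0, negative ones included, so the boundary contributes
    -- nothing and its measure is not needed.
    simp [weight, this, Real.zero_rpow ha]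
  have hcont : Continuous fun p => g (deltoidMap p) * (ω p : ℂ) :=
    (hg.comp continuous_deltoidMap).mul (Complex.continuous_ofReal.comp hω)
  have step2 : ∀ σ, ∫ z in {z | 0 < deltoidFun z}, g z * (weight a z : ℂ) =
      (κ : ℂ) * ∫ p in alcove σ, g (deltoidMap p) * (ω p : ℂ) := by
    intro σ
    rw [← image_alcove σ, integral_image_eq_integral_abs_det_fderiv_smul volume
      (measurableSet_alcove σ) (fun p _ => (hasFDerivAt_deltoidMap p).hasFDerivWithinAt)
      (injOn_deltoidMap σ), ← integral_const_mul]
    refine setIntegral_congr_fun (measurableSet_alcove σ) fun p hp => ?_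
    have hp' := h p ((torusTriple_injective_iff p).1 (alcove_injective hp))
    simp only [det_smulRight]
    rw [← deltoidJac, Complex.real_smul]
    have hp2 := congrArg (fun r : ℝ => (r : ℂ)) hp'
    push_cast at hp2
    linear_combination g (deltoidMap p) * hp2
  have step3 : ∫ p in torusBox, g (deltoidMap p) * (ω p : ℂ) =
      ∑ σ, ∫ p in alcove σ, g (deltoidMap p) * (ω p : ℂ) := by
    rw [← integral_iUnion_fintype measurableSet_alcove pairwise_disjoint_alcove
      (fun σ => (integrableOn_torusBox hcont).mono_set Set.inter_subset_left), iUnion_alcove]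
    refine setIntegral_congr_set ?_
    symm
    refine inter_ae_eq_left_of_ae_eq_univ ?_
    rw [Filter.eventuallyEq_univ, mem_ae_iff]
    convert volume_weylDenom_eq_zero using 2
    ext p
    simp
  rw [step1, step3]
  have hsum : ∑ σ : Equiv.Perm (Fin 3), ∫ z in {z | 0 < deltoidFun z}, g z * (weight a z : ℂ) =
      (κ : ℂ) * ∑ σ, ∫ p in alcove σ, g (deltoidMap p) * (ω p : ℂ) := by
    rw [Finset.mul_sum]
    exact Finset.sum_congr rfl fun σ _ => step2 σ
  -- Each of the 3! = 6 alcoves covers the open deltoid once, hence the factor 1/6.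
  rw [Finset.sum_const, Finset.card_univ, Fintype.card_perm, Fintype.card_fin] at hsum
  simp only [Nat.factorial, nsmul_eq_mul] at hsum
  push_cast at hsum ⊢
  linear_combination hsum / 6

/-! ### The two weights transported to the torus. -/

lemma jac_mul_weight_neg_half (p : ℂ) (hp : weylDenom p ≠ 0) :
    |deltoidJac p| * weight (-1 / 2) (deltoidMap p) = (Real.sqrt 12)⁻¹ * 1 := by
  have hJ : deltoidJac p ≠ 0 := fun h => hp (by rw [weylDenom_eq, h]; simp)
  rw [weight, deltoidFun_deltoidMap, show (-1 / 2 : ℝ) = -(1 / 2) by norm_num,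
    Real.rpow_neg (by positivity), ← Real.sqrt_eq_rpow, Real.sqrt_mul (by norm_num),
    Real.sqrt_sq_eq_abs]
  have := abs_pos.2 hJ
  field_simp

lemma jac_mul_weight_half (p : ℂ) :
    |deltoidJac p| * weight (1 / 2) (deltoidMap p) =
      (Real.sqrt 12 / 324) * Complex.normSq (weylDenom p) := by
  rw [weight, deltoidFun_deltoidMap, ← Real.sqrt_eq_rpow, Real.sqrt_mul (by norm_num),
    Real.sqrt_sq_eq_abs, normSq_weylDenom, ← sq_abs (deltoidJac p)]
  ring

lemma continuous_evalAt (P : CPoly) : Continuous fun z => evalAt z P := by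
  unfold evalAt
  refine (MvPolynomial.continuous_eval P).comp ?_
  refine continuous_pi fun i => ?_
  fin_cases i
  · exact continuous_id
  · exact Complex.continuous_conj

/-- The constant κ/6 cancels because the inner product is divided by the total mass. -/
lemma innerW_eq_torus {a κ : ℝ} (ha : a ≠ 0) (hκ : κ ≠ 0) {ω : ℂ → ℝ} (hω : Continuous ω)
    (h : ∀ p, weylDenom p ≠ 0 → |deltoidJac p| * weight a (deltoidMap p) = κ * ω p)
    (P Q : CPoly) : innerW a P Q =
      (∫ p in torusBox, evalAt (deltoidMap p) P * (starRingEnd ℂ) (evalAt (deltoidMap p) Q) *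
        (ω p : ℂ)) / ∫ p in torusBox, (ω p : ℂ) := by
  have h1 := integral_deltoid ha hω h (g := fun z => evalAt z P * (starRingEnd ℂ) (evalAt z Q))
    ((continuous_evalAt P).mul (Complex.continuous_conj.comp (continuous_evalAt Q)))
  have h2 := integral_deltoid ha hω h (g := fun _ => 1) continuous_const
  simp only [one_mul] at h2
  rw [integral_complex_ofReal] at h2
  rw [innerW, h1, h2, mul_div_mul_left]
  rw [Complex.ofReal_ne_zero]
  positivity

lemma innerW_neg_half (P Q : CPoly) : innerW (-1 / 2) P Q =
    (∫ p in torusBox, evalAt (deltoidMap p) P * (starRingEnd ℂ) (evalAt (deltoidMap p) Q)) /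
      ∫ _ in torusBox, (1 : ℂ) := by
  have := innerW_eq_torus (a := -1 / 2) (by norm_num) (inv_ne_zero (by norm_num))
    (ω := fun _ => 1) continuous_const jac_mul_weight_neg_half P Q
  simpa using this

lemma innerW_half (P Q : CPoly) : innerW (1 / 2) P Q =
    (∫ p in torusBox, (weylDenom p * evalAt (deltoidMap p) P) *
      (starRingEnd ℂ) (weylDenom p * evalAt (deltoidMap p) Q)) /
      ∫ p in torusBox, weylDenom p * (starRingEnd ℂ) (weylDenom p) := by
  have := innerW_eq_torus (a := 1 / 2) (κ := Real.sqrt 12 / 324) (by norm_num) (by positivity)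
    (ω := fun p => Complex.normSq (weylDenom p))
    (Complex.continuous_normSq.comp continuous_weylDenom) (fun p _ => jac_mul_weight_half p) P Q
  rw [this]
  congr 1
  · refine integral_congr_ae (Filter.Eventually.of_forall fun p => ?_)
    simp only [← Complex.mul_conj, map_mul]
    ring
  · simp only [Complex.mul_conj]

/-! ### Orthogonality on the torus -/

/-- The character with exponents `v` on the torus. -/
noncomputable def torusChar (v : ℤ × ℤ) (p : ℂ) : ℂ :=
  Complex.exp (v.1 * Complex.I * (p.re : ℝ)) * Complex.exp (v.2 * Complex.I * (p.im : ℝ))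

lemma continuous_torusChar (v : ℤ × ℤ) : Continuous (torusChar v) := by
  unfold torusChar
  fun_prop

lemma torusChar_mul_conj (v w : ℤ × ℤ) (p : ℂ) :
    torusChar v p * (starRingEnd ℂ) (torusChar w p) = torusChar (v - w) p := by
  simp only [torusChar, map_mul, ← Complex.exp_conj]
  simp only [Complex.conj_I, Complex.conj_ofReal, map_intCast, ← Complex.exp_add]
  congr 1
  push_cast [Prod.fst_sub, Prod.snd_sub]
  ring

lemma setIntegral_exp_int (m : ℤ) :
    ∫ x in Set.Ioc (-Real.pi) Real.pi, Complex.exp (m * Complex.I * (x : ℝ)) =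
      if m = 0 then 2 * (Real.pi : ℂ) else 0 := by
  rw [← intervalIntegral.integral_of_le (by linarith [Real.pi_pos])]
  split_ifs with h
  · simp [h]
    ring
  · rw [integral_exp_mul_complex (mul_ne_zero (by exact_mod_cast h) Complex.I_ne_zero)]
    have : Complex.exp (m * Complex.I * (Real.pi : ℝ)) =
        Complex.exp (m * Complex.I * ((-Real.pi : ℝ) : ℂ)) := by
      rw [Complex.exp_eq_exp_iff_exists_int]
      exact ⟨m, by push_cast; ring⟩
    rw [this, sub_self, zero_div]

lemma integral_torusChar (v : ℤ × ℤ) :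
    ∫ p in torusBox, torusChar v p = if v = 0 then (2 * (Real.pi : ℂ)) ^ 2 else 0 := by
  have h := (Complex.volume_preserving_equiv_real_prod).setIntegral_preimage_emb
    Complex.measurableEquivRealProd.measurableEmbedding
    (fun q : ℝ × ℝ => Complex.exp (v.1 * Complex.I * (q.1 : ℝ)) *
      Complex.exp (v.2 * Complex.I * (q.2 : ℝ)))
    (Set.Ioc (-Real.pi) Real.pi ×ˢ Set.Ioc (-Real.pi) Real.pi)
  have e : Complex.measurableEquivRealProd ⁻¹'
      (Set.Ioc (-Real.pi) Real.pi ×ˢ Set.Ioc (-Real.pi) Real.pi) = torusBox := by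
    ext p
    simp [torusBox, Complex.mem_reProdIm, Complex.measurableEquivRealProd_apply]
  rw [e, Measure.volume_eq_prod, setIntegral_prod_mul
    (fun x : ℝ => Complex.exp (v.1 * Complex.I * (x : ℝ)))
    (fun x : ℝ => Complex.exp (v.2 * Complex.I * (x : ℝ))), setIntegral_exp_int,
    setIntegral_exp_int] at h
  refine Eq.trans ?_ (h.trans ?_)
  · rfl
  · obtain ⟨m, n⟩ := v
    by_cases hm : m = 0 <;> by_cases hn : n = 0 <;> simp [hm, hn, sq]

lemma integral_torusBox_one : ∫ _ in torusBox, (1 : ℂ) = (2 * (Real.pi : ℂ)) ^ 2 := by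
  simpa [torusChar] using integral_torusChar 0

/-- The orbit of a weight, in the exponents of the first two coordinates. -/
def weylOrbit (a b : ℤ) : Fin 6 → ℤ × ℤ :=
  ![(a + b, b), (-b, a), (-a, -a - b), (-a - b, -a), (a, -b), (b, a + b)]

/-- The coefficients of the orbit sum. -/
def weylSign (ε : ℂ) : Fin 6 → ℂ := ![1, 1, 1, ε, ε, ε]

lemma torusMono_exp (u v : ℝ) (a b : ℤ) :
    torusMono (Complex.exp (u * Complex.I)) (Complex.exp (v * Complex.I)) a b =
      Complex.exp ((a * u - b * v) * Complex.I) := by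
  rw [torusMono, ← Complex.exp_int_mul, ← Complex.exp_int_mul, ← Complex.exp_add]
  congr 1
  push_cast
  ring

lemma weylSum_torusTriple (ε : ℂ) (p : ℂ) (a b : ℤ) :
    weylSum ε (torusTriple p 0) (torusTriple p 1) (torusTriple p 2) a b =
      ∑ i, weylSign ε i * torusChar (weylOrbit a b i) p := by
  simp only [weylSum, torusTriple, Matrix.cons_val, torusMono_exp, Fin.sum_univ_six,
    weylSign, weylOrbit, torusChar, ← Complex.exp_add]
  push_cast
  ring_nf

lemma integral_weylSum {ε : ℂ} (hr : (starRingEnd ℂ) ε = ε) (a b c d : ℤ) :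
    ∫ p in torusBox,
      weylSum ε (torusTriple p 0) (torusTriple p 1) (torusTriple p 2) a b * (starRingEnd ℂ)
        (weylSum ε (torusTriple p 0) (torusTriple p 1) (torusTriple p 2) c d) =
      (∑ i, ∑ j, weylSign ε i * weylSign ε j *
        if weylOrbit a b i = weylOrbit c d j then 1 else 0) * (2 * (Real.pi : ℂ)) ^ 2 := by
  have hs : ∀ j, (starRingEnd ℂ) (weylSign ε j) = weylSign ε j := by
    intro j
    fin_cases j <;> simp [weylSign, hr]
  have e : ∀ p, weylSum ε (torusTriple p 0) (torusTriple p 1) (torusTriple p 2) a b *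
      (starRingEnd ℂ) (weylSum ε (torusTriple p 0) (torusTriple p 1) (torusTriple p 2) c d) =
      ∑ i, ∑ j, weylSign ε i * weylSign ε j * torusChar (weylOrbit a b i - weylOrbit c d j) p := by
    intro p
    rw [weylSum_torusTriple, weylSum_torusTriple, map_sum, Finset.sum_mul_sum]
    refine Finset.sum_congr rfl fun i _ => Finset.sum_congr rfl fun j _ => ?_
    rw [map_mul, hs, ← torusChar_mul_conj]
    ring
  have hint : ∀ i j, Integrable (fun p => weylSign ε i * weylSign ε j *
      torusChar (weylOrbit a b i - weylOrbit c d j) p) (volume.restrict torusBox) := fun i j =>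
    integrableOn_torusBox (continuous_const.mul (continuous_torusChar _))
  simp only [e]
  rw [integral_finsetSum _ fun i _ => integrable_finsetSum _ fun j _ => hint i j, Finset.sum_mul]
  refine Finset.sum_congr rfl fun i _ => ?_
  rw [integral_finsetSum _ fun j _ => hint i j, Finset.sum_mul]
  refine Finset.sum_congr rfl fun j _ => ?_
  rw [integral_const_mul, integral_torusChar]
  simp only [sub_eq_zero]
  split_ifs <;> ring

/-- Each orbit meets the closed Weyl chamber a, b ≥ 0 in one weight only. -/
lemma eq_of_weylOrbit_eq {a b c d : ℤ} (ha : 0 ≤ a) (hb : 0 ≤ b) (hc : 0 ≤ c) (hd : 0 ≤ d)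
    {i j : Fin 6} (h : weylOrbit a b i = weylOrbit c d j) : a = c ∧ b = d := by
  fin_cases i <;> fin_cases j <;> simp [weylOrbit] at h <;> omega

lemma weylOrbit_regular {a b : ℤ} (ha : 0 < a) (hb : 0 < b) (i j : Fin 6) :
    weylOrbit a b i = weylOrbit a b j ↔ i = j := by
  constructor
  · intro h
    fin_cases i <;> fin_cases j <;> simp [weylOrbit] at h ⊢ <;> omega
  · rintro rfl
    rfl

/-- A nonzero weight on a wall has a stabilizer of order two, so its six orbit entries coincide in
three pairs. -/
lemma weylOrbit_wall {a : ℤ} (ha : 0 < a) (i j : Fin 6) :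
    weylOrbit a 0 i = weylOrbit a 0 j ↔
      (![0, 1, 2, 2, 0, 1] : Fin 6 → Fin 3) i = (![0, 1, 2, 2, 0, 1] : Fin 6 → Fin 3) j := by
  fin_cases i <;> fin_cases j <;> simp [weylOrbit] <;> omega

lemma integral_weylSum_ne {ε : ℂ} (hr : (starRingEnd ℂ) ε = ε) {a b c d : ℤ} (ha : 0 ≤ a)
    (hb : 0 ≤ b) (hc : 0 ≤ c) (hd : 0 ≤ d) (hne : ¬(a = c ∧ b = d)) :
    ∫ p in torusBox,
      weylSum ε (torusTriple p 0) (torusTriple p 1) (torusTriple p 2) a b * (starRingEnd ℂ)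
        (weylSum ε (torusTriple p 0) (torusTriple p 1) (torusTriple p 2) c d) = 0 := by
  rw [integral_weylSum hr, Finset.sum_eq_zero, zero_mul]
  intro i _
  refine Finset.sum_eq_zero fun j _ => ?_
  rw [if_neg fun h => hne (eq_of_weylOrbit_eq ha hb hc hd h), mul_zero]

lemma integral_weylSum_regular {ε : ℂ} (hr : (starRingEnd ℂ) ε = ε) (hε : ε * ε = 1) {a b : ℤ}
    (ha : 0 < a) (hb : 0 < b) :
    ∫ p in torusBox,
      weylSum ε (torusTriple p 0) (torusTriple p 1) (torusTriple p 2) a b * (starRingEnd ℂ)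
        (weylSum ε (torusTriple p 0) (torusTriple p 1) (torusTriple p 2) a b) =
      6 * (2 * (Real.pi : ℂ)) ^ 2 := by
  rw [integral_weylSum hr]
  simp only [weylOrbit_regular ha hb, mul_ite, mul_one, mul_zero, Finset.sum_ite_eq,
    Finset.mem_univ, if_true, Fin.sum_univ_six]
  simp [weylSign, hε]
  norm_num

/-- Three distinct characters, each with coefficient 2, give 3 · 2² = 12. -/
lemma integral_weylSum_wall {a : ℤ} (ha : 0 < a) :
    ∫ p in torusBox,
      weylSum 1 (torusTriple p 0) (torusTriple p 1) (torusTriple p 2) a 0 * (starRingEnd ℂ)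
        (weylSum 1 (torusTriple p 0) (torusTriple p 1) (torusTriple p 2) a 0) =
      12 * (2 * (Real.pi : ℂ)) ^ 2 := by
  have hs : ∀ i, weylSign 1 i = 1 := by
    intro i
    fin_cases i <;> rfl
  rw [integral_weylSum (by simp)]
  simp only [weylOrbit_wall ha, hs, Fin.sum_univ_six]
  simp [-mul_eq_mul_right_iff]
  norm_num

lemma innerW_conjPoly (a : ℝ) (P Q : CPoly) :
    innerW a (conjPoly P) (conjPoly Q) = innerW a Q P := by
  simp only [innerW, evalAt_conjPoly, Complex.conj_conj, mul_comm]

lemma evalAt_deltoidMap (p : ℂ) (P : CPoly) : evalAt (deltoidMap p) P =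
    eval (torusPt (torusTriple p 0) (torusTriple p 1) (torusTriple p 2)) P :=
  evalAt_eq_eval_torusPt (norm_torusTriple p 0) (norm_torusTriple p 1) (norm_torusTriple p 2) P

lemma two_pi_sq_ne_zero : (2 * (Real.pi : ℂ)) ^ 2 ≠ 0 := by
  have : (Real.pi : ℂ) ≠ 0 := by exact_mod_cast Real.pi_ne_zero
  exact pow_ne_zero 2 (mul_ne_zero two_ne_zero this)

lemma innerW_chebT (n k m j : ℕ) (hk : k ≤ n) (hj : j ≤ m) :
    innerW (-1 / 2) (chebT n k) (chebT m j) = (∫ p in torusBox,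
      weylSum 1 (torusTriple p 0) (torusTriple p 1) (torusTriple p 2) ((n : ℤ) - k) k *
        (starRingEnd ℂ)
        (weylSum 1 (torusTriple p 0) (torusTriple p 1) (torusTriple p 2) ((m : ℤ) - j) j)) /
        (36 * (2 * (Real.pi : ℂ)) ^ 2) := by
  rw [innerW_neg_half, integral_torusBox_one]
  have h6 : (starRingEnd ℂ) (6 : ℂ) = 6 := map_ofNat _ _
  simp only [evalAt_deltoidMap, ← eval_chebT _ _ hk (torusTriple_prod _),
    ← eval_chebT _ _ hj (torusTriple_prod _), map_mul, h6]
  rw [mul_comm (36 : ℂ), ← div_div, div_right_comm]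
  congr 1
  rw [eq_div_iff (by norm_num), ← integral_mul_const]
  congr 1
  ext p
  ring

lemma innerW_chebU (n k m j : ℕ) (hk : k ≤ n) (hj : j ≤ m) :
    innerW (1 / 2) (chebU n k) (chebU m j) = (∫ p in torusBox,
      weylSum (-1) (torusTriple p 0) (torusTriple p 1) (torusTriple p 2) ((n : ℤ) - k + 1) (k + 1) *
        (starRingEnd ℂ) (weylSum (-1) (torusTriple p 0) (torusTriple p 1) (torusTriple p 2)
          ((m : ℤ) - j + 1) (j + 1))) / (6 * (2 * (Real.pi : ℂ)) ^ 2) := by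
  have hw : ∀ p, weylDenom p =
      weylSum (-1) (torusTriple p 0) (torusTriple p 1) (torusTriple p 2) 1 1 := fun p =>
    (weylSum_neg_one_one_one (torusTriple_prod p)).symm
  rw [innerW_half]
  simp only [hw]
  rw [integral_weylSum_regular (by simp) (by norm_num) one_pos one_pos]
  simp only [evalAt_deltoidMap, eval_chebU _ _ hk (torusTriple_prod _),
    eval_chebU _ _ hj (torusTriple_prod _)]

/-- The squared norms of the Chebyshev polynomials of the first kind. -/
noncomputable def normT (n k : ℕ) : ℝ :=
  if n = 0 then 1 else if k = 0 ∨ k = n then 1 / 3 else 1 / 6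

lemma innerW_chebT_ne {n k m j : ℕ} (hk : k ≤ n) (hj : j ≤ m) (h : ¬(n = m ∧ k = j)) :
    innerW (-1 / 2) (chebT n k) (chebT m j) = 0 := by
  rw [innerW_chebT n k m j hk hj, integral_weylSum_ne (by simp) (by omega) (by omega) (by omega)
    (by omega) (by omega), zero_div]

lemma innerW_chebU_ne {n k m j : ℕ} (hk : k ≤ n) (hj : j ≤ m) (h : ¬(n = m ∧ k = j)) :
    innerW (1 / 2) (chebU n k) (chebU m j) = 0 := by
  rw [innerW_chebU n k m j hk hj, integral_weylSum_ne (by simp) (by omega) (by omega) (by omega)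
    (by omega) (by omega), zero_div]

lemma innerW_chebU_self {n k : ℕ} (hk : k ≤ n) :
    innerW (1 / 2) (chebU n k) (chebU n k) = ((1 : ℝ) : ℂ) := by
  rw [innerW_chebU n k n k hk hk, integral_weylSum_regular (by simp) (by norm_num) (by omega)
    (by omega)]
  have := two_pi_sq_ne_zero
  rw [div_self (mul_ne_zero (by norm_num) this), Complex.ofReal_one]

lemma innerW_chebT_self {n k : ℕ} (hk : k ≤ n) :
    innerW (-1 / 2) (chebT n k) (chebT n k) = (normT n k : ℂ) := by
  have hpi := two_pi_sq_ne_zero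
  have wall : ∀ n, n ≠ 0 → innerW (-1 / 2) (chebT n 0) (chebT n 0) = 1 / 3 := by
    intro n hn
    rw [innerW_chebT n 0 n 0 (by omega) (by omega)]
    simp only [Nat.cast_zero, sub_zero]
    rw [integral_weylSum_wall (by omega)]
    field_simp
    norm_num
  rw [normT]
  by_cases hn : n = 0
  · subst hn
    obtain rfl : k = 0 := by omega
    rw [if_pos rfl, innerW_neg_half]
    simp only [chebT, if_true, evalAt, map_one, one_mul]
    rw [integral_torusBox_one, div_self hpi, Complex.ofReal_one]
  rw [if_neg hn]
  by_cases h : k = 0 ∨ k = n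
  · rw [if_pos h]
    push_cast
    rcases h with rfl | rfl
    · exact wall n hn
    · rw [chebT_conj k k le_rfl, Nat.sub_self, innerW_conjPoly, wall k hn]
  · rw [if_neg h, innerW_chebT n k n k hk hk, integral_weylSum_regular (by simp) (by norm_num)
      (by omega) (by omega)]
    field_simp
    norm_num

/-! ### Orthonormal systems with prescribed leading terms -/

/-- The inner product `innerW a` is an integral over the torus against a continuous weight. -/
def IsTorusWeight (a : ℝ) : Prop :=
  ∃ ω : ℂ → ℝ, Continuous ω ∧ ∃ c : ℂ, ∀ P Q : CPoly, innerW a P Q =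
    (∫ p in torusBox, evalAt (deltoidMap p) P * (starRingEnd ℂ) (evalAt (deltoidMap p) Q) *
      (ω p : ℂ)) / c

lemma isTorusWeight_neg_half : IsTorusWeight (-1 / 2) :=
  ⟨fun _ => 1, continuous_const, _, fun P Q => innerW_eq_torus (by norm_num)
    (inv_ne_zero (by norm_num)) continuous_const jac_mul_weight_neg_half P Q⟩

lemma isTorusWeight_half : IsTorusWeight (1 / 2) :=
  ⟨fun p => Complex.normSq (weylDenom p), Complex.continuous_normSq.comp continuous_weylDenom, _,
    fun P Q => innerW_eq_torus (κ := Real.sqrt 12 / 324) (by norm_num) (by positivity)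
      (Complex.continuous_normSq.comp continuous_weylDenom)
      (fun p _ => jac_mul_weight_half p) P Q⟩

lemma evalAt_mul (z : ℂ) (P Q : CPoly) : evalAt z (P * Q) = evalAt z P * evalAt z Q :=
  map_mul _ _ _

lemma evalAt_add (z : ℂ) (P Q : CPoly) : evalAt z (P + Q) = evalAt z P + evalAt z Q :=
  map_add _ _ _

lemma evalAt_sub (z : ℂ) (P Q : CPoly) : evalAt z (P - Q) = evalAt z P - evalAt z Q :=
  map_sub _ _ _

lemma evalAt_smul (z c : ℂ) (P : CPoly) : evalAt z (c • P) = c * evalAt z P := by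
  simp [evalAt, smul_eq_C_mul]

lemma evalAt_C (z c : ℂ) : evalAt z (C c) = c := by
  simp [evalAt]

lemma evalAt_X_zero (z : ℂ) : evalAt z (X 0) = z := by
  simp [evalAt]

lemma evalAt_X_one (z : ℂ) : evalAt z (X 1) = (starRingEnd ℂ) z := by
  simp [evalAt]

/-- The inner product as a linear map in its first argument. -/
noncomputable def innerLin {a : ℝ} (h : IsTorusWeight a) (Q : CPoly) : CPoly →ₗ[ℂ] ℂ where
  toFun P := innerW a P Q
  map_add' P R := by
    obtain ⟨ω, hω, c, h⟩ := h
    have hint : ∀ P : CPoly, Integrable (fun p => evalAt (deltoidMap p) P *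
        (starRingEnd ℂ) (evalAt (deltoidMap p) Q) * (ω p : ℂ)) (volume.restrict torusBox) := by
      intro P
      refine integrableOn_torusBox (((((continuous_evalAt P).comp continuous_deltoidMap).mul
        (Complex.continuous_conj.comp ((continuous_evalAt Q).comp continuous_deltoidMap)))).mul
        (Complex.continuous_ofReal.comp hω))
    rw [h, h, h, ← add_div, ← integral_add (hint P) (hint R)]
    congr 2
    ext p
    rw [evalAt_add]
    ring
  map_smul' r P := by
    obtain ⟨ω, hω, c, h⟩ := h
    rw [h, h, RingHom.id_apply, smul_eq_mul, ← mul_div_assoc, ← integral_const_mul]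
    congr 2
    ext p
    rw [evalAt_smul]
    ring

lemma innerLin_apply {a : ℝ} (h : IsTorusWeight a) (P Q : CPoly) :
    innerLin h Q P = innerW a P Q := rfl

lemma innerLin_C_mul {a : ℝ} (h : IsTorusWeight a) (c : ℂ) (P Q : CPoly) :
    innerLin h Q (C c * P) = c * innerLin h Q P := by
  rw [← smul_eq_C_mul, map_smul, smul_eq_mul]

lemma conj_innerW (a : ℝ) (P Q : CPoly) :
    (starRingEnd ℂ) (innerW a P Q) = innerW a Q P := by
  rw [innerW, innerW, map_div₀, Complex.conj_ofReal, ← integral_conj]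
  congr 2
  ext z
  simp only [map_mul, Complex.conj_conj, Complex.conj_ofReal]
  ring

lemma innerW_swap_eq_zero {a : ℝ} {P Q : CPoly} (h : innerW a P Q = 0) : innerW a Q P = 0 := by
  rw [← conj_innerW, h, map_zero]

lemma X_one_mul_mem_polyLT {n : ℕ} {P : CPoly} (h : P ∈ polyLT n) : X 1 * P ∈ polyLT (n + 1) := by
  have : polyLT n ≤ (polyLT (n + 1)).comap (LinearMap.mulLeft ℂ (X 1)) :=
    polyLT_le fun i j hij => by
      have : X 1 * mon i j = mon i (j + 1) := by
        simp only [mon]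
        ring
      simpa [this] using mon_mem_polyLT (show i + (j + 1) < n + 1 by omega)
  exact this h

/-- Orthonormal polynomials `Q n k` with leading monomials `z ^ (n - k) * z̄ ^ k`. -/
structure OrthoSystem (a : ℝ) (Q : (n : ℕ) → Fin (n + 1) → CPoly) : Prop where
  torus : IsTorusWeight a
  lead : ∀ n k, HasLead (Q n k) n k
  conj : ∀ n k, Q n k = conjPoly (Q n k.rev)
  orthonormal : ∀ n j k, innerW a (Q n j) (Q n k) = if j = k then 1 else 0
  orthogonal : ∀ m n j k, m ≠ n → innerW a (Q m j) (Q n k) = 0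

namespace OrthoSystem

variable {a : ℝ} {Q : (n : ℕ) → Fin (n + 1) → CPoly}

lemma mem_polyLT (h : OrthoSystem a Q) (n : ℕ) (k : Fin (n + 1)) : Q n k ∈ polyLT (n + 1) :=
  (h.lead n k).mem (by omega)

/-- Triangularity: a monomial of degree n is a multiple of the corresponding member of `Q n` plus
lower degree. -/
lemma polyLT_le_span (h : OrthoSystem a Q) (n : ℕ) :
    polyLT n ≤ Submodule.span ℂ {P | ∃ m k, m < n ∧ P = Q m k} := by
  induction n with
  | zero => exact polyLT_le fun i j hij => by omega
  | succ n ih =>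
    have hle : polyLT n ≤ Submodule.span ℂ {P | ∃ m k, m < n + 1 ∧ P = Q m k} :=
      ih.trans (Submodule.span_mono fun P ⟨m, k, hm, hP⟩ => ⟨m, k, by omega, hP⟩)
    refine polyLT_le fun i j hij => ?_
    by_cases hlt : i + j < n
    · exact hle (mon_mem_polyLT hlt)
    obtain rfl : n = i + j := by omega
    obtain ⟨c, hc, hlow⟩ := h.lead (i + j) ⟨j, by omega⟩
    simp only [Nat.add_sub_cancel] at hlow
    have e : mon i j = C c⁻¹ * (Q (i + j) ⟨j, by omega⟩ -
        (Q (i + j) ⟨j, by omega⟩ - C c * mon i j)) := by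
      rw [sub_sub_cancel, ← mul_assoc, ← map_mul, inv_mul_cancel₀ hc, C_1, one_mul]
    rw [e]
    refine C_mul_mem _ (sub_mem (Submodule.subset_span ?_) (hle hlow))
    exact ⟨_, _, by omega, rfl⟩

/-- Both sides are linear in `f` and agree, by orthonormality, on the spanning family. -/
lemma expansion (h : OrthoSystem a Q) {n : ℕ} {f : CPoly} (hf : f ∈ polyLT n) :
    f = ∑ m ∈ Finset.range n, ∑ k, C (innerW a f (Q m k)) * Q m k := by
  let L : CPoly →ₗ[ℂ] CPoly :=
    ∑ m ∈ Finset.range n, ∑ k, (innerLin h.torus (Q m k)).smulRight (Q m k)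
  have hL : ∀ g, L g = ∑ m ∈ Finset.range n, ∑ k, C (innerW a g (Q m k)) * Q m k := by
    intro g
    simp [L, innerLin_apply, smul_eq_C_mul]
  have key : Set.EqOn (LinearMap.id : CPoly →ₗ[ℂ] CPoly) L
      (Submodule.span ℂ {P | ∃ m k, m < n ∧ P = Q m k} : Set CPoly) := by
    refine LinearMap.eqOn_span ?_
    rintro _ ⟨m, k, hm, rfl⟩
    rw [hL, Finset.sum_eq_single_of_mem m (Finset.mem_range.2 hm)]
    · simp [h.orthonormal]
    · intro m' _ hne
      exact Finset.sum_eq_zero fun k' _ => by rw [h.orthogonal m m' k k' hne.symm]; simp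
  rw [← hL]
  exact key (h.polyLT_le_span n hf)

lemma innerW_of_mem (h : OrthoSystem a Q) {n : ℕ} {R : CPoly} (hR : R ∈ polyLT n)
    (k : Fin (n + 1)) : innerW a R (Q n k) = 0 := by
  have hle : Submodule.span ℂ {P | ∃ m k, m < n ∧ P = Q m k} ≤
      LinearMap.ker (innerLin h.torus (Q n k)) := by
    rw [Submodule.span_le]
    rintro _ ⟨m, j, hm, rfl⟩
    exact h.orthogonal m n j k (by omega)
  exact hle (h.polyLT_le_span n hR)

lemma isOrthonormalBasis (h : OrthoSystem a Q) (n : ℕ) : IsOrthonormalBasis a n (Q n) where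
  orthonormal := h.orthonormal n
  conj_symm := h.conj n
  span_eq := by
    ext f
    constructor
    · intro hf
      refine ⟨?_, fun R hR => ?_⟩
      · have : Submodule.span ℂ (Set.range (Q n)) ≤ polyLT (n + 1) := by
          rw [Submodule.span_le]
          rintro _ ⟨k, rfl⟩
          exact h.mem_polyLT n k
        exact this hf
      · have : Submodule.span ℂ (Set.range (Q n)) ≤ LinearMap.ker (innerLin h.torus R) := by
          rw [Submodule.span_le]
          rintro _ ⟨k, rfl⟩
          exact innerW_swap_eq_zero (h.innerW_of_mem hR k)
        exact this hf
    · rintro ⟨hf, horth⟩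
      rw [h.expansion hf, Finset.sum_range_succ, Finset.sum_eq_zero, zero_add]
      · exact sum_mem fun k _ => C_mul_mem _ (Submodule.subset_span ⟨k, rfl⟩)
      · intro m hm
        refine Finset.sum_eq_zero fun k _ => ?_
        rw [horth _ (polyLT_mono (Finset.mem_range.1 hm) (h.mem_polyLT m k)), map_zero, zero_mul]

end OrthoSystem

/-! ### Coefficient matrices of the three-term relation. -/

lemma mulVecPoly_apply {n m : ℕ} (M : Matrix (Fin n) (Fin m) ℂ) (Q : Fin m → CPoly) (i : Fin n) :
    mulVecPoly M Q i = ∑ j, C (M i j) * Q j := rfl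

lemma backId_apply {n : ℕ} (i j : Fin n) : backId n i j = if j = i.rev then 1 else 0 := rfl

lemma mul_backId_apply {n m : ℕ} (M : Matrix (Fin n) (Fin m) ℂ) (i : Fin n) (j : Fin m) :
    (M * backId m) i j = M i j.rev := by
  rw [Matrix.mul_apply, Finset.sum_eq_single_of_mem j.rev (Finset.mem_univ _)]
  · rw [backId_apply, if_pos (Fin.rev_rev j).symm, mul_one]
  · intro k _ hk
    rw [backId_apply, if_neg, mul_zero]
    rintro rfl
    exact hk (Fin.rev_rev k).symm

lemma backId_mul_apply {n m : ℕ} (M : Matrix (Fin n) (Fin m) ℂ) (i : Fin n) (j : Fin m) :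
    (backId n * M) i j = M i.rev j := by
  rw [Matrix.mul_apply, Finset.sum_eq_single_of_mem i.rev (Finset.mem_univ _)]
  · rw [backId_apply, if_pos rfl, one_mul]
  · intro k _ hk
    rw [backId_apply, if_neg hk, zero_mul]

lemma vee_apply {n m : ℕ} (M : Matrix (Fin n) (Fin m) ℂ) (i : Fin n) (j : Fin m) :
    vee M i j = (starRingEnd ℂ) (M i.rev j.rev) := by
  rw [vee, mul_backId_apply, backId_mul_apply, Matrix.map_apply]

namespace OrthoSystem

variable {a : ℝ} {Q : (n : ℕ) → Fin (n + 1) → CPoly}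

lemma exists_threeTerm (h : OrthoSystem a Q) : ∃ α β, ThreeTerm Q α β := by
  refine ⟨fun n => Matrix.of fun i j => innerW a (X 0 * Q n i) (Q (n + 1) j),
    fun n => Matrix.of fun i j => innerW a (X 0 * Q n i) (Q n j), ?_, ?_⟩
  · ext1 i
    have := h.expansion (X_mul_mem_polyLT (h.mem_polyLT 0 i))
    rw [Finset.sum_range_succ, Finset.sum_range_succ, Finset.sum_range_zero, zero_add] at this
    simp only [Pi.add_apply, mulVecPoly_apply, Matrix.of_apply]
    rw [add_comm]
    exact this
  · intro n
    ext1 i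
    have := h.expansion (X_mul_mem_polyLT (h.mem_polyLT (n + 1) i))
    rw [Finset.sum_range_succ, Finset.sum_range_succ, Finset.sum_range_succ, Finset.sum_eq_zero,
      zero_add] at this
    · refine this.trans ?_
      simp only [Pi.add_apply, mulVecPoly_apply, Matrix.of_apply, vee_apply,
        Matrix.conjTranspose_apply, ← starRingEnd_apply, Complex.conj_conj]
      -- Conjugation symmetry turns the coefficient of `Q n j` into an entry of α_n at reversed
      -- indices, which is what `vee` of the adjoint encodes.
      have e : ∀ j, innerW a (X 0 * Q (n + 1) i) (Q n j) =
          innerW a (X 0 * Q n j.rev) (Q (n + 1) i.rev) := by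
        intro j
        rw [h.conj (n + 1) i, h.conj n j]
        simp only [innerW, evalAt_mul, evalAt_conjPoly, Complex.conj_conj]
        congr 2
        ext z
        ring
      simp only [e]
      ring
    · intro m hm
      refine Finset.sum_eq_zero fun k _ => ?_
      -- The adjoint of multiplication by z is multiplication by z̄. It raises the degree by one, so
      -- the components with m < n vanish.
      have e : innerW a (X 0 * Q (n + 1) i) (Q m k) = innerW a (Q (n + 1) i) (X 1 * Q m k) := by
        simp only [innerW, evalAt_mul, evalAt_X_zero, evalAt_X_one, map_mul, Complex.conj_conj]
        congr 2
        ext z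
        ring
      have hm' := Finset.mem_range.1 hm
      rw [e, innerW_swap_eq_zero (h.innerW_of_mem (polyLT_mono (by omega)
        (X_one_mul_mem_polyLT (h.mem_polyLT m k))) i), map_zero, zero_mul]

lemma innerLin_mulVecPoly_same (h : OrthoSystem a Q) {l n : ℕ}
    (M : Matrix (Fin l) (Fin (n + 1)) ℂ) (i : Fin l) (j : Fin (n + 1)) :
    innerLin h.torus (Q n j) (mulVecPoly M (Q n) i) = M i j := by
  simp only [mulVecPoly_apply, map_sum, innerLin_C_mul]
  simp [innerLin_apply, h.orthonormal]

lemma innerLin_mulVecPoly_ne (h : OrthoSystem a Q) {l m n : ℕ} (hmn : m ≠ n)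
    (M : Matrix (Fin l) (Fin (m + 1)) ℂ) (i : Fin l) (j : Fin (n + 1)) :
    innerLin h.torus (Q n j) (mulVecPoly M (Q m) i) = 0 := by
  simp only [mulVecPoly_apply, map_sum, innerLin_C_mul]
  simp [innerLin_apply, h.orthogonal m n _ j hmn]

/-- Orthonormality forces the coefficients, so whether (*) holds does not depend on the chosen
relation. -/
lemma threeTerm_alpha (h : OrthoSystem a Q) {α β} (H : ThreeTerm Q α β) (n : ℕ) (i : Fin (n + 1))
    (j : Fin (n + 2)) : α n i j = innerW a (X 0 * Q n i) (Q (n + 1) j) := by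
  rw [← innerLin_apply h.torus]
  cases n with
  | zero =>
    have := congrFun H.zero i
    rw [this, Pi.add_apply, map_add, h.innerLin_mulVecPoly_same (n := 1),
      h.innerLin_mulVecPoly_ne (m := 0) (by omega), add_zero]
  | succ n =>
    have := congrFun (H.succ n) i
    rw [this, Pi.add_apply, Pi.add_apply, map_add, map_add,
      h.innerLin_mulVecPoly_same (n := n + 2),
      h.innerLin_mulVecPoly_ne (m := n + 1) (by omega),
      h.innerLin_mulVecPoly_ne (m := n) (by omega), add_zero, add_zero]

end OrthoSystem

/-- Orthogonal polynomials `P n k`, `k ≤ n`, with leading monomials `z ^ (n - k) * z̄ ^ k` and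
squared norms `N n k`. -/
structure OrthoFamily (a : ℝ) (P : ℕ → ℕ → CPoly) (N : ℕ → ℕ → ℝ) : Prop where
  torus : IsTorusWeight a
  lead : ∀ n k, k ≤ n → HasLead (P n k) n k
  conj : ∀ n k, k ≤ n → P n k = conjPoly (P n (n - k))
  pos : ∀ n k, k ≤ n → 0 < N n k
  norm : ∀ n k, k ≤ n → innerW a (P n k) (P n k) = (N n k : ℂ)
  orthogonal : ∀ n k m j, k ≤ n → j ≤ m → ¬(n = m ∧ k = j) → innerW a (P n k) (P m j) = 0

namespace OrthoFamily

variable {a : ℝ} {P : ℕ → ℕ → CPoly} {N : ℕ → ℕ → ℝ}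

lemma normalize_eq (h : OrthoFamily a P N) {n k : ℕ} (hk : k ≤ n) :
    normalize a (P n k) = C (((Real.sqrt (N n k))⁻¹ : ℝ) : ℂ) * P n k := by
  rw [normalize, h.norm n k hk, Complex.ofReal_re]

lemma sqrt_ne_zero (h : OrthoFamily a P N) {n k : ℕ} (hk : k ≤ n) :
    ((Real.sqrt (N n k) : ℝ) : ℂ) ≠ 0 := by
  rw [Complex.ofReal_ne_zero]
  exact (Real.sqrt_pos.2 (h.pos n k hk)).ne'

lemma innerW_C_mul_C_mul (h : OrthoFamily a P N) (r s : ℝ) (R S : CPoly) :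
    innerW a (C (r : ℂ) * R) (C (s : ℂ) * S) = r * s * innerW a R S := by
  rw [← innerLin_apply h.torus, innerLin_C_mul, innerLin_apply, ← conj_innerW,
    ← innerLin_apply h.torus, innerLin_C_mul, innerLin_apply, map_mul, conj_innerW,
    Complex.conj_ofReal]
  ring

lemma orthoSystem (h : OrthoFamily a P N) :
    OrthoSystem a fun n (k : Fin (n + 1)) => normalize a (P n k) where
  torus := h.torus
  lead n k := by
    have hk : (k : ℕ) ≤ n := by omega
    rw [h.normalize_eq hk]
    refine (h.lead n k hk).C_mul ?_
    rw [Complex.ofReal_inv]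
    exact inv_ne_zero (h.sqrt_ne_zero hk)
  conj n k := by
    have hk : (k : ℕ) ≤ n := by omega
    have e : ((k.rev : Fin (n + 1)) : ℕ) = n - k := by
      rw [Fin.val_rev]
      omega
    rw [normalize, normalize, conjPoly_C_mul, Complex.conj_ofReal, e, ← h.conj n k hk,
      show innerW a (P n (n - k)) (P n (n - k)) = innerW a (P n k) (P n k) by
        rw [← innerW_conjPoly, ← h.conj n k hk]]
  orthonormal n j k := by
    have hj : (j : ℕ) ≤ n := by omega
    have hk : (k : ℕ) ≤ n := by omega
    rw [h.normalize_eq hj, h.normalize_eq hk, h.innerW_C_mul_C_mul]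
    split_ifs with hjk
    · subst hjk
      have h0 := h.sqrt_ne_zero hj
      rw [h.norm n j hj]
      have h1 : ((Real.sqrt (N n j) : ℝ) : ℂ) * ((Real.sqrt (N n j) : ℝ) : ℂ) = (N n j : ℂ) := by
        rw [← Complex.ofReal_mul, Real.mul_self_sqrt (h.pos n j hj).le]
      rw [← h1]
      push_cast
      field_simp
    · rw [h.orthogonal n j n k hj hk (by rintro ⟨-, h'⟩; exact hjk (Fin.ext h')), mul_zero]
  orthogonal m n j k hmn := by
    have hj : (j : ℕ) ≤ m := by omega
    have hk : (k : ℕ) ≤ n := by omega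
    rw [h.normalize_eq hj, h.normalize_eq hk, h.innerW_C_mul_C_mul,
      h.orthogonal m j n k hj hk (by tauto), mul_zero]

/-- The remainder has degree at most n and is orthogonal to level n+1. Each row of α_n therefore has
a single possibly nonzero entry, rescaled by the ratio of the two norms. -/
lemma innerW_X_mul (h : OrthoFamily a P N) {n : ℕ} (i : Fin (n + 1)) (j : Fin (n + 2)) {c : ℂ}
    (hc : 3 * X 0 * P n i - C c * P (n + 1) i ∈ polyLT (n + 1)) :
    innerW a (X 0 * normalize a (P n i)) (normalize a (P (n + 1) j)) =
      if j = i.castSucc then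
        c / 3 * ((Real.sqrt (N (n + 1) i) / Real.sqrt (N n i) : ℝ) : ℂ) else 0 := by
  have hi : (i : ℕ) ≤ n := by omega
  have hi' : (i : ℕ) ≤ n + 1 := by omega
  have h0 := h.sqrt_ne_zero hi
  have h0' := h.sqrt_ne_zero hi'
  set R := 3 * X 0 * P n i - C c * P (n + 1) i with hR
  have e : X 0 * normalize a (P n i) =
      C (c / 3 * ((Real.sqrt (N (n + 1) i) / Real.sqrt (N n i) : ℝ) : ℂ)) *
        normalize a (P (n + 1) i) + C (1 / 3 * (((Real.sqrt (N n i))⁻¹ : ℝ) : ℂ)) * R := by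
    have h3 : (C (1 / 3 : ℂ) : CPoly) * 3 = 1 := by
      rw [three_eq_C, ← map_mul]
      norm_num
    have e1 : (C (c / 3 * ((Real.sqrt (N (n + 1) i) / Real.sqrt (N n i) : ℝ) : ℂ)) : CPoly) *
        C (((Real.sqrt (N (n + 1) i))⁻¹ : ℝ) : ℂ) =
        C (1 / 3 * (((Real.sqrt (N n i))⁻¹ : ℝ) : ℂ)) * C c := by
      rw [← map_mul, ← map_mul]
      congr 1
      push_cast
      field_simp
    rw [h.normalize_eq hi, h.normalize_eq hi', ← mul_assoc (C (c / 3 * _)), e1, hR, map_mul]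
    linear_combination -(X 0 * C (((Real.sqrt (N n i))⁻¹ : ℝ) : ℂ) * P n i) * h3
  have hs := h.orthoSystem
  rw [e, ← innerLin_apply h.torus, map_add, innerLin_C_mul, innerLin_C_mul, innerLin_apply,
    innerLin_apply, hs.innerW_of_mem hc j, mul_zero, add_zero]
  have := hs.orthonormal (n + 1) i.castSucc j
  rw [Fin.val_castSucc] at this
  rw [this]
  by_cases hij : j = i.castSucc
  · simp [hij]
  · rw [if_neg (Ne.symm hij), if_neg hij, mul_zero]

lemma alpha_mul_conjTranspose (h : OrthoFamily a P N) {n : ℕ} (i j : Fin (n + 1)) {c d : ℝ}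
    (hc : 3 * X 0 * P n i - C (c : ℂ) * P (n + 1) i ∈ polyLT (n + 1))
    (hd : 3 * X 0 * P n j - C (d : ℂ) * P (n + 1) j ∈ polyLT (n + 1)) {α β}
    (H : ThreeTerm (fun n (k : Fin (n + 1)) => normalize a (P n k)) α β) :
    (α n * (α n)ᴴ) i j = if i = j then ((c ^ 2 / 9 * (N (n + 1) i / N n i) : ℝ) : ℂ) else 0 := by
  have hα := h.orthoSystem.threeTerm_alpha H n
  simp only [Matrix.mul_apply, Matrix.conjTranspose_apply, hα, h.innerW_X_mul i _ hc,
    h.innerW_X_mul j _ hd]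
  simp only [ite_mul, zero_mul, Finset.sum_ite_eq', Finset.mem_univ, if_true, Fin.castSucc_inj]
  by_cases hij : i = j
  · subst hij
    -- On the diagonal `c` and `d` describe the same inner product, so their entries agree.
    have hcd : (d : ℂ) / 3 * ((Real.sqrt (N (n + 1) i) / Real.sqrt (N n i) : ℝ) : ℂ) =
        (c : ℂ) / 3 * ((Real.sqrt (N (n + 1) i) / Real.sqrt (N n i) : ℝ) : ℂ) := by
      have := (h.innerW_X_mul i i.castSucc hd).symm.trans (h.innerW_X_mul i i.castSucc hc)
      simpa using this
    rw [if_pos rfl, if_pos rfl, hcd, ← Complex.ofReal_ofNat, ← Complex.ofReal_div,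
      ← Complex.ofReal_mul, ← starRingEnd_apply, Complex.conj_ofReal, ← Complex.ofReal_mul]
    congr 1
    have h1 := Real.sq_sqrt (h.pos n i (by omega)).le
    have h2 := Real.sq_sqrt (h.pos (n + 1) i (by omega)).le
    rw [← h1, ← h2, Real.sqrt_sq (Real.sqrt_nonneg _), Real.sqrt_sq (Real.sqrt_nonneg _)]
    ring
  · rw [if_neg hij, if_neg hij, star_zero, mul_zero]

end OrthoFamily

/-! ### The condition (*) for the two Chebyshev families. -/

lemma orthoFamily_chebU : OrthoFamily (1 / 2) chebU fun _ _ => 1 where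
  torus := isTorusWeight_half
  lead := chebU_hasLead
  conj := chebU_conj
  pos _ _ _ := one_pos
  norm _ _ hk := innerW_chebU_self hk
  orthogonal _ _ _ _ hk hj h := innerW_chebU_ne hk hj h

lemma orthoFamily_chebT : OrthoFamily (-1 / 2) chebT normT where
  torus := isTorusWeight_neg_half
  lead := chebT_hasLead
  conj := chebT_conj
  pos n k _ := by
    unfold normT
    split_ifs <;> norm_num
  norm _ _ hk := innerW_chebT_self hk
  orthogonal _ _ _ _ hk hj h := innerW_chebT_ne hk hj h

lemma three_X_mul_chebU (n k : ℕ) (hk : k ≤ n) :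
    3 * X 0 * chebU n k - C ((1 : ℝ) : ℂ) * chebU (n + 1) k ∈ polyLT (n + 1) := by
  rw [Complex.ofReal_one, C_1, one_mul]
  cases n with
  | zero =>
    obtain rfl : k = 0 := by omega
    simp [chebU]
  | succ n =>
    by_cases k0 : k = 0
    · subst k0
      rw [chebU, if_pos rfl, sub_sub_cancel]
      exact (chebU_hasLead (n + 1) 1 (by omega)).mem (by omega)
    by_cases k1 : k ≤ n
    · rw [chebU, if_neg k0, if_pos k1, sub_sub, sub_sub_cancel]
      exact add_mem ((chebU_hasLead (n + 1) (k + 1) (by omega)).mem (by omega))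
        (polyLT_mono (by omega) ((chebU_hasLead n (k - 1) (by omega)).mem (by omega)))
    · obtain rfl : k = n + 1 := by omega
      rw [chebU, if_neg k0, if_neg k1, if_pos rfl, sub_sub_cancel]
      exact polyLT_mono (by omega) ((chebU_hasLead n n le_rfl).mem le_rfl)

lemma three_X_mul_chebT_zero (n : ℕ) :
    3 * X 0 * chebT (n + 1) 0 - C ((1 : ℝ) : ℂ) * chebT (n + 2) 0 ∈ polyLT (n + 2) := by
  rw [Complex.ofReal_one, C_1, one_mul, chebT, if_pos rfl, sub_sub, sub_sub_cancel]
  have := (chebT_hasLead (n + 1) 1 (by omega)).mem (by omega)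
  exact add_mem this this

lemma two_mul_chebT (n : ℕ) : C 2 * chebT (n + 2) (n + 1) =
    3 * X 0 * chebT (n + 1) (n + 1) - chebT n n := by
  rw [chebT, if_neg (by omega), if_neg (by omega), if_pos rfl, ← mul_assoc, ← map_mul]
  norm_num

lemma three_X_mul_chebT_last (n : ℕ) :
    3 * X 0 * chebT (n + 1) (n + 1) - C ((2 : ℝ) : ℂ) * chebT (n + 2) (n + 1) ∈
      polyLT (n + 2) := by
  rw [Complex.ofReal_ofNat, two_mul_chebT, sub_sub_cancel]
  exact polyLT_mono (by omega) ((chebT_hasLead n n le_rfl).mem le_rfl)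

/-- Multiplication by J on the right reverses the columns; a scalar matrix then gives a multiple of
J, which is symmetric. -/
lemma maxZeroCond_vecU {α β} (H : ThreeTerm vecU α β) (n : ℕ) : MaxZeroCond (α n) := by
  have key : α n * (α n)ᴴ = Matrix.diagonal fun _ => ((1 ^ 2 / 9 * (1 / 1) : ℝ) : ℂ) := by
    ext i j
    rw [orthoFamily_chebU.alpha_mul_conjTranspose i j (three_X_mul_chebU n i (by omega))
      (three_X_mul_chebU n j (by omega)) H, Matrix.diagonal_apply]
  rw [MaxZeroCond, key]
  ext i j
  rw [Matrix.transpose_apply, mul_backId_apply, mul_backId_apply, Matrix.diagonal_apply,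
    Matrix.diagonal_apply]
  have : i = j.rev ↔ j = i.rev := by rw [eq_comm, Fin.rev_eq_iff]
  simp only [this]

lemma not_maxZeroCond_vecT {α β} (H : ThreeTerm vecT α β) (n : ℕ) :
    ¬ MaxZeroCond (α (n + 1)) := by
  intro hcond
  have h1 := congrFun (congrFun hcond 0) (Fin.last (n + 1))
  rw [Matrix.transpose_apply, mul_backId_apply, mul_backId_apply, Fin.rev_last, Fin.rev_zero] at h1
  have z : 3 * X 0 * chebT (n + 1) ((0 : Fin (n + 2)) : ℕ) -
      C ((1 : ℝ) : ℂ) * chebT (n + 1 + 1) ((0 : Fin (n + 2)) : ℕ) ∈ polyLT (n + 1 + 1) :=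
    three_X_mul_chebT_zero n
  have l : 3 * X 0 * chebT (n + 1) (Fin.last (n + 1) : ℕ) -
      C ((2 : ℝ) : ℂ) * chebT (n + 1 + 1) (Fin.last (n + 1) : ℕ) ∈ polyLT (n + 1 + 1) :=
    three_X_mul_chebT_last n
  -- The first diagonal entry is 1/9 · (1/3)/(1/3) = 1/9. The last one, with c = 2 and a weight
  -- leaving the wall, is 4/9 · (1/6)/(1/3) = 2/9.
  rw [orthoFamily_chebT.alpha_mul_conjTranspose 0 0 z z H,
    orthoFamily_chebT.alpha_mul_conjTranspose _ _ l l H, if_pos rfl, if_pos rfl,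
    Complex.ofReal_inj] at h1
  simp [normT] at h1
  norm_num at h1

/-! ### Common zeros -/

lemma mon_mul_mon (i j k l : ℕ) : mon i j * mon k l = mon (i + k) (j + l) := by
  simp only [mon]
  ring

lemma mon_mul_mem_polyLT (i j : ℕ) {n : ℕ} {P : CPoly} (h : P ∈ polyLT n) :
    mon i j * P ∈ polyLT (n + (i + j)) := by
  have : polyLT n ≤ (polyLT (n + (i + j))).comap (LinearMap.mulLeft ℂ (mon i j)) :=
    polyLT_le fun k l hkl => by
      simpa [mon_mul_mon] using mon_mem_polyLT (show i + k + (j + l) < n + (i + j) by omega)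
  exact this h

/-- The polynomials that agree on `Z` with a polynomial of degree less than `n`. -/
noncomputable def reducible (Z : Set ℂ) (n : ℕ) : Submodule ℂ CPoly where
  carrier := {R | ∃ S ∈ polyLT n, ∀ z ∈ Z, evalAt z R = evalAt z S}
  zero_mem' := ⟨0, zero_mem _, fun _ _ => rfl⟩
  add_mem' := by
    rintro R R' ⟨S, hS, h⟩ ⟨S', hS', h'⟩
    exact ⟨S + S', add_mem hS hS', fun z hz => by rw [evalAt_add, evalAt_add, h z hz, h' z hz]⟩
  smul_mem' := by
    rintro c R ⟨S, hS, h⟩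
    exact ⟨c • S, Submodule.smul_mem _ c hS, fun z hz => by
      rw [evalAt_smul, evalAt_smul, h z hz]⟩

/-- On `Z` each monomial of degree n equals a polynomial of lower degree; multiplying by monomials
lowers any degree n + d step by step. -/
lemma polyLT_le_reducible {n : ℕ} {P : ℕ → CPoly} (hP : ∀ k ≤ n, HasLead (P k) n k) {Z : Set ℂ}
    (hZ : ∀ z ∈ Z, ∀ k ≤ n, evalAt z (P k) = 0) (d : ℕ) : polyLT (n + d) ≤ reducible Z n := by
  induction d with
  | zero => exact fun S hS => ⟨S, hS, fun _ _ => rfl⟩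
  | succ d ih =>
    refine polyLT_le fun i j hij => ?_
    by_cases hlt : i + j < n + d
    · exact ih (mon_mem_polyLT hlt)
    -- With k = min(j, n) the monomial of exponents (n-k, k) divides that of (i, j), since i + j ≥
    -- n.
    obtain ⟨k, hkn, hki, hkj⟩ : ∃ k ≤ n, n - k ≤ i ∧ k ≤ j := ⟨min j n, by omega, by omega, by omega⟩
    obtain ⟨c, hc, hlow⟩ := hP k hkn
    have hc' : (C c⁻¹ : CPoly) * C c = 1 := by rw [← map_mul, inv_mul_cancel₀ hc, C_1]
    have hm : mon i j = mon (i - (n - k)) (j - k) * mon (n - k) k := by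
      rw [mon_mul_mon, Nat.sub_add_cancel hki, Nat.sub_add_cancel hkj]
    have e : mon i j = C c⁻¹ * (mon (i - (n - k)) (j - k) * P k) -
        C c⁻¹ * (mon (i - (n - k)) (j - k) * (P k - C c * mon (n - k) k)) := by
      rw [hm]
      linear_combination -(mon (i - (n - k)) (j - k) * mon (n - k) k) * hc'
    rw [e]
    refine sub_mem (C_mul_mem _ ⟨0, zero_mem _, fun z hz => ?_⟩) (C_mul_mem _ (ih ?_))
    · rw [evalAt_mul, hZ z hz k hkn, mul_zero, evalAt, map_zero]
    · have := mon_mul_mem_polyLT (i - (n - k)) (j - k) hlow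
      rwa [show n + (i - (n - k) + (j - k)) = n + d by omega] at this

instance finiteDimensional_polyLT (n : ℕ) : FiniteDimensional ℂ (polyLT n) := by
  have : Finite {s : Fin 2 →₀ ℕ | s.degree < n} := Finsupp.finite_of_degree_lt n
  exact Module.Finite.of_basis (basisRestrictSupport ℂ {s : Fin 2 →₀ ℕ | s.degree < n})

/-- Evaluation of polynomials of degree less than `n` at the points of a finite set. -/
noncomputable def evalOn (n : ℕ) (s : Finset ℂ) : polyLT n →ₗ[ℂ] (s → ℂ) where
  toFun R z := evalAt z R
  map_add' R S := by
    ext z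
    exact evalAt_add _ _ _
  map_smul' c R := by
    ext z
    exact evalAt_smul _ _ _

/-- Distinct points have distinct z, so Lagrange interpolation in z alone attains any values; the
interpolant is then reduced to degree less than n. -/
lemma evalOn_surjective {n : ℕ} {P : ℕ → CPoly} (hP : ∀ k ≤ n, HasLead (P k) n k) (s : Finset ℂ)
    (hs : ∀ z ∈ s, ∀ k ≤ n, evalAt z (P k) = 0) : Function.Surjective (evalOn n s) := by
  intro r
  let f : Polynomial ℂ := Lagrange.interpolate Finset.univ (fun z : s => (z : ℂ)) r
  have hf : ∀ z : s, evalAt z (Polynomial.aeval (X 0 : CPoly) f) = r z := by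
    intro z
    have h1 : evalAt z (Polynomial.aeval (X 0 : CPoly) f) = f.eval (z : ℂ) := by
      rw [evalAt, ← MvPolynomial.coe_aeval_eq_eval, RingHom.coe_coe, ← Polynomial.aeval_algHom_apply]
      simp
    rw [h1]
    exact Lagrange.eval_interpolate_at_node r Subtype.val_injective.injOn (Finset.mem_univ z)
  obtain ⟨m, hm⟩ := exists_mem_polyLT (Polynomial.aeval (X 0 : CPoly) f)
  obtain ⟨S, hS, h⟩ := polyLT_le_reducible (Z := (s : Set ℂ)) hP hs m
    (polyLT_mono (Nat.le_add_left m n) hm)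
  refine ⟨⟨S, hS⟩, ?_⟩
  ext z
  rw [← hf z]
  exact (h z z.2).symm

lemma card_add_finrank_ker {n : ℕ} {P : ℕ → CPoly} (hP : ∀ k ≤ n, HasLead (P k) n k)
    (s : Finset ℂ) (hs : ∀ z ∈ s, ∀ k ≤ n, evalAt z (P k) = 0) :
    s.card + Module.finrank ℂ (LinearMap.ker (evalOn n s)) = Module.finrank ℂ (polyLT n) := by
  rw [← LinearMap.finrank_range_add_finrank_ker (evalOn n s),
    LinearMap.range_eq_top.2 (evalOn_surjective hP s hs), finrank_top,
    Module.finrank_fintype_fun_eq_card, Fintype.card_coe]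

lemma encard_le_of_finset {Z : Set ℂ} {N : ℕ} (h : ∀ s : Finset ℂ, (s : Set ℂ) ⊆ Z → s.card ≤ N) :
    Z.encard ≤ N := by
  by_contra hlt
  rw [not_le] at hlt
  obtain ⟨t, ht, hcard⟩ := Set.exists_subset_encard_eq (Order.add_one_le_of_lt hlt)
  have hfin : t.Finite := Set.finite_of_encard_eq_coe (k := N + 1) hcard
  have h1 := h hfin.toFinset (by simpa using ht)
  rw [hfin.encard_eq_coe_toFinset_card] at hcard
  have h2 : hfin.toFinset.card = N + 1 := by exact_mod_cast hcard
  omega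

lemma encard_zeros_le {n : ℕ} {P : ℕ → CPoly} (hP : ∀ k ≤ n, HasLead (P k) n k) {Z : Set ℂ}
    (hZ : ∀ z ∈ Z, ∀ k ≤ n, evalAt z (P k) = 0) :
    Z.encard ≤ (Module.finrank ℂ (polyLT n) : ℕ∞) :=
  encard_le_of_finset fun s hs => by
    have := card_add_finrank_ker hP s fun z hz => hZ z (hs hz)
    omega

/-- `R` lies in the kernel of every evaluation map, which costs one dimension in the count. -/
lemma encard_zeros_lt {n : ℕ} {P : ℕ → CPoly} (hP : ∀ k ≤ n, HasLead (P k) n k) {Z : Set ℂ}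
    (hZ : ∀ z ∈ Z, ∀ k ≤ n, evalAt z (P k) = 0) {R : CPoly} (hR : R ∈ polyLT n) (hR0 : R ≠ 0)
    (hRZ : ∀ z ∈ Z, evalAt z R = 0) : Z.encard < (Module.finrank ℂ (polyLT n) : ℕ∞) := by
  have key : ∀ s : Finset ℂ, (s : Set ℂ) ⊆ Z → s.card + 1 ≤ Module.finrank ℂ (polyLT n) := by
    intro s hs
    have h1 := card_add_finrank_ker hP s fun z hz => hZ z (hs hz)
    have h2 : Module.finrank ℂ (LinearMap.ker (evalOn n s)) ≠ 0 := by
      intro h0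
      have h3 : (⟨R, hR⟩ : polyLT n) ∈ LinearMap.ker (evalOn n s) := by
        rw [LinearMap.mem_ker]
        ext z
        exact hRZ z (hs z.2)
      rw [Submodule.finrank_eq_zero.1 h0, Submodule.mem_bot] at h3
      exact hR0 (congrArg Subtype.val h3)
    omega
  have h0 := key ∅ (by simp)
  refine lt_of_le_of_lt (encard_le_of_finset (N := Module.finrank ℂ (polyLT n) - 1) fun s hs => ?_) ?_
  · have := key s hs
    omega
  · rw [Nat.cast_lt]
    simp only [Finset.card_empty] at h0
    omega

lemma OrthoFamily.mem_commonZeros {a : ℝ} {P : ℕ → ℕ → CPoly} {N : ℕ → ℕ → ℝ}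
    (h : OrthoFamily a P N) {n : ℕ} {z : ℂ} :
    z ∈ commonZeros (fun k : Fin (n + 1) => normalize a (P n k)) ↔
      ∀ k ≤ n, evalAt z (P n k) = 0 := by
  have key : ∀ k ≤ n, evalAt z (normalize a (P n k)) = 0 ↔ evalAt z (P n k) = 0 := by
    intro k hk
    rw [h.normalize_eq hk, evalAt_mul, evalAt_C, mul_eq_zero, Complex.ofReal_inv, inv_eq_zero,
      or_iff_right (h.sqrt_ne_zero hk)]
  constructor
  · intro hz k hk
    exact (key k hk).1 (hz ⟨k, by omega⟩)
  · intro hz k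
    exact (key k (by omega)).2 (hz k (by omega))

/-- At a common zero T_n^{n+1} is computed twice. Its own recurrence gives 2 T_n^{n+1} =
-T_{n-1}^{n-1}, while conjugating the recurrence of T_1^{n+1} gives T_n^{n+1} = -T_{n-1}^{n-1}.
Hence T_{n-1}^{n-1} vanishes there. -/
lemma encard_commonZeros_vecT_lt (n : ℕ) (hn : 2 ≤ n) :
    (commonZeros (vecT n)).encard < (Module.finrank ℂ (polyLT n) : ℕ∞) := by
  obtain ⟨m, rfl⟩ : ∃ m, n = m + 2 := ⟨n - 2, by omega⟩
  have hZ : ∀ z ∈ commonZeros (vecT (m + 2)), ∀ k ≤ m + 2, evalAt z (chebT (m + 2) k) = 0 :=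
    fun z hz => orthoFamily_chebT.mem_commonZeros.1 hz
  refine encard_zeros_lt (chebT_hasLead (m + 2)) hZ
    ((chebT_hasLead (m + 1) (m + 1) le_rfl).mem le_rfl)
    ((chebT_hasLead (m + 1) (m + 1) le_rfl).ne_zero le_rfl) fun z hz => ?_
  have h1 := congrArg (evalAt z) (two_mul_chebT (m + 1))
  rw [evalAt_sub, evalAt_mul, evalAt_mul, hZ z hz (m + 2) (by omega), evalAt_C] at h1
  -- This recurrence involves T_2^{m+2}, so it is here that n = m + 2 ≥ 2 matters.
  have h2 : evalAt z (chebT (m + 3) 1) = - evalAt z (chebT (m + 1) 0) := by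
    rw [chebT, if_neg (by omega), if_pos (by omega), evalAt_sub, evalAt_sub, evalAt_mul,
      hZ z hz 1 (by omega), hZ z hz 2 (by omega)]
    ring
  have h3 := congrArg (starRingEnd ℂ) h2
  rw [map_neg, ← evalAt_conjPoly, ← evalAt_conjPoly] at h3
  have h4 := chebT_conj (m + 3) (m + 2) (by omega)
  rw [show m + 3 - (m + 2) = 1 by omega] at h4
  have h5 := chebT_conj (m + 1) (m + 1) (by omega)
  rw [Nat.sub_self] at h5
  rw [← h4, ← h5] at h3
  rw [show m + 1 + 2 = m + 3 by omega, show m + 1 + 1 = m + 2 by omega, h3] at h1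
  linear_combination -h1

/-! ### The nodes: common zeros of the polynomials of the second kind. -/

/-- The exponents of a node in the alcove. -/
def nodeExp (p q : ℤ) : Fin 3 → ℤ := ![2 * p + q, q - p, -p - 2 * q]

/-- Exponents in the open alcove differ by less than 6N in absolute value, so a multiple of 3N among
the differences is 0 or ±3N. The finitely many systems for two indices are then linear. -/
lemma eq_of_nodeExp_modEq {N p q p' q' : ℤ} (hp : 0 < p) (hq : 0 < q) (hpq : p + q < N)
    (hp' : 0 < p') (hq' : 0 < q') (hpq' : p' + q' < N)
    (h : ∀ i, ∃ j, 3 * N ∣ nodeExp p q i - nodeExp p' q' j) : p = p' ∧ q = q' := by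
  have bound : ∀ i j k, nodeExp p q i - nodeExp p' q' j = 3 * N * k → k = -1 ∨ k = 0 ∨ k = 1 := by
    intro i j k hk
    have h1 : 3 * N * k < 3 * N * 2 := by
      rw [← hk]
      fin_cases i <;> fin_cases j <;> simp [nodeExp] <;> omega
    have h2 : 3 * N * (-2) < 3 * N * k := by
      rw [← hk]
      fin_cases i <;> fin_cases j <;> simp [nodeExp] <;> omega
    have h3 := lt_of_mul_lt_mul_left h1 (by omega)
    have h4 := lt_of_mul_lt_mul_left h2 (by omega)
    omega
  obtain ⟨j0, k0, h0⟩ := h 0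
  obtain ⟨j1, k1, h1⟩ := h 1
  have b0 := bound _ _ _ h0
  have b1 := bound _ _ _ h1
  fin_cases j0 <;> fin_cases j1 <;> simp [nodeExp] at h0 h1 <;>
    rcases b0 with rfl | rfl | rfl <;> rcases b1 with rfl | rfl | rfl <;> omega

/-- A primitive root of unity of order `3 * (n + 2)`. -/
noncomputable def nodeRoot (n : ℕ) : ℂ :=
  Complex.exp (2 * Real.pi * Complex.I / ((3 * (n + 2) : ℕ) : ℂ))

lemma nodeRoot_isPrimitiveRoot (n : ℕ) : IsPrimitiveRoot (nodeRoot n) (3 * (n + 2)) :=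
  Complex.isPrimitiveRoot_exp _ (by omega)

lemma nodeRoot_ne_zero (n : ℕ) : nodeRoot n ≠ 0 := Complex.exp_ne_zero _

lemma nodeRoot_zpow_eq_iff (n : ℕ) (u v : ℤ) :
    nodeRoot n ^ u = nodeRoot n ^ v ↔ 3 * ((n : ℤ) + 2) ∣ u - v := by
  have h := (nodeRoot_isPrimitiveRoot n).zpow_eq_one_iff_dvd (u - v)
  rw [zpow_sub₀ (nodeRoot_ne_zero n), div_eq_one_iff_eq (zpow_ne_zero _ (nodeRoot_ne_zero n))] at h
  rw [h]
  push_cast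
  rfl

/-- The triple attached to a node. -/
noncomputable def nodeTriple (n : ℕ) (p q : ℤ) (i : Fin 3) : ℂ := nodeRoot n ^ nodeExp p q i

/-- The node with coordinates `p`, `q`. -/
noncomputable def node (n : ℕ) (p q : ℤ) : ℂ :=
  (nodeTriple n p q 0 + nodeTriple n p q 1 + nodeTriple n p q 2) / 3

lemma norm_nodeTriple (n : ℕ) (p q : ℤ) (i : Fin 3) : ‖nodeTriple n p q i‖ = 1 := by
  rw [nodeTriple, norm_zpow, (nodeRoot_isPrimitiveRoot n).norm'_eq_one (by omega), _root_.one_zpow]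

lemma nodeTriple_prod (n : ℕ) (p q : ℤ) :
    nodeTriple n p q 0 * nodeTriple n p q 1 * nodeTriple n p q 2 = 1 := by
  simp only [nodeTriple]
  rw [← zpow_add₀ (nodeRoot_ne_zero n), ← zpow_add₀ (nodeRoot_ne_zero n)]
  simp only [nodeExp, Matrix.cons_val]
  rw [show 2 * p + q + (q - p) + (-p - 2 * q) = 0 by ring, zpow_zero]

lemma node_injective {n : ℕ} {p q p' q' : ℤ} (hp : 0 < p) (hq : 0 < q) (hpq : p + q < n + 2)
    (hp' : 0 < p') (hq' : 0 < q') (hpq' : p' + q' < n + 2) (h : node n p q = node n p' q') :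
    p = p' ∧ q = q' := by
  refine eq_of_nodeExp_modEq hp hq hpq hp' hq' hpq' fun i => ?_
  obtain ⟨j, hj⟩ := exists_eq_of_sum_eq (norm_nodeTriple n p q) (norm_nodeTriple n p' q')
    (nodeTriple_prod n p q) (nodeTriple_prod n p' q')
    (by simp only [node] at h; linear_combination 3 * h) i
  exact ⟨j, (nodeRoot_zpow_eq_iff n _ _).1 hj⟩

lemma torusMono_nodeRoot (n : ℕ) (u v a b : ℤ) :
    torusMono (nodeRoot n ^ u) (nodeRoot n ^ v) a b = nodeRoot n ^ (u * a - v * b) := by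
  rw [torusMono, ← _root_.zpow_mul, ← _root_.zpow_mul, ← zpow_add₀ (nodeRoot_ne_zero n), mul_neg,
    ← sub_eq_add_neg]

/-- In Weyl's formula the denominator survives, since the exponents differ by 3p, 3q and 3(p+q), all
strictly between 0 and 3(n+2), whereas the numerator vanishes. -/
lemma evalAt_node_chebU {n k : ℕ} (hk : k ≤ n) {p q : ℤ} (hp : 0 < p) (hq : 0 < q)
    (hpq : p + q < n + 2) : evalAt (node n p q) (chebU n k) = 0 := by
  rw [node, evalAt_eq_eval_torusPt (norm_nodeTriple n p q 0) (norm_nodeTriple n p q 1)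
    (norm_nodeTriple n p q 2)]
  have h := eval_chebU n k hk (nodeTriple_prod n p q)
  have hv : weylSum (-1) (nodeTriple n p q 0) (nodeTriple n p q 1) (nodeTriple n p q 2) 1 1 ≠ 0 := by
    rw [weylSum_neg_one_one_one (nodeTriple_prod n p q)]
    have small : ∀ d : ℤ, 0 < d → d < n + 2 → ∀ u v, u - v = 3 * d →
        nodeRoot n ^ u - nodeRoot n ^ v ≠ 0 := by
      intro d hd hd' u v huv h0
      have h1 := (nodeRoot_zpow_eq_iff n u v).1 (sub_eq_zero.1 h0)
      rw [huv] at h1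
      have := Int.le_of_dvd (by omega) h1
      omega
    refine mul_ne_zero (mul_ne_zero (small p hp (by omega) _ _ ?_) (small q hq (by omega) _ _ ?_))
      (small (p + q) (by omega) hpq _ _ ?_)
    · simp [nodeExp]
      ring
    · simp [nodeExp]
      ring
    · simp [nodeExp]
      ring
  have hz : weylSum (-1) (nodeTriple n p q 0) (nodeTriple n p q 1) (nodeTriple n p q 2)
      ((n : ℤ) - k + 1) (k + 1) = 0 := by
    -- Exchanging u and v changes the exponent by (u - v)(n + 2) = 3l(n + 2), a multiple of the
    -- order; the positive and negative terms of the numerator cancel in pairs.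
    have flip : ∀ u v l : ℤ, u - v = 3 * l →
        nodeRoot n ^ (u * ((n : ℤ) - k + 1) - v * (k + 1)) =
          nodeRoot n ^ (v * ((n : ℤ) - k + 1) - u * (k + 1)) := by
      intro u v l hl
      rw [nodeRoot_zpow_eq_iff]
      exact ⟨l, by linear_combination (n + 2 : ℤ) * hl⟩
    simp only [weylSum, nodeTriple, torusMono_nodeRoot]
    simp only [nodeExp, Matrix.cons_val]
    rw [flip (2 * p + q) (-p - 2 * q) (p + q) (by ring),
      flip (q - p) (2 * p + q) (-p) (by ring),
      flip (-p - 2 * q) (q - p) (-q) (by ring)]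
    ring
  rw [hz] at h
  exact (mul_eq_zero.1 h).resolve_left hv

lemma encard_commonZeros_vecU (n : ℕ) :
    (commonZeros (vecU n)).encard = (Module.finrank ℂ (polyLT n) : ℕ∞) := by
  apply le_antisymm
  · exact encard_zeros_le (chebU_hasLead n) fun z hz => orthoFamily_chebU.mem_commonZeros.1 hz
  · let ι := {s : Fin 2 →₀ ℕ | s.degree < n}
    have hfin : Finite ι := Finsupp.finite_of_degree_lt n
    -- Shifting both exponents by 1 turns i + j < n into p, q ≥ 1 and p + q < n + 2, so the nodes
    -- are indexed by the monomial basis of `polyLT n` and need no separate count.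
    let φ : ι → ℂ := fun s => node n ((s : Fin 2 →₀ ℕ) 0 + 1) ((s : Fin 2 →₀ ℕ) 1 + 1)
    have hlt : ∀ s : ι, (((s : Fin 2 →₀ ℕ) 0 : ℤ) + 1) + (((s : Fin 2 →₀ ℕ) 1 : ℤ) + 1) < n + 2 := by
      rintro ⟨s, hs⟩
      have : s 0 + s 1 < n := by simpa [ι, Finsupp.degree_eq_sum, Fin.sum_univ_two] using hs
      simp only
      omega
    have hinj : Function.Injective φ := by
      intro s t hst
      obtain ⟨h0, h1⟩ := node_injective (by omega) (by omega) (hlt s) (by omega) (by omega) (hlt t) hst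
      apply Subtype.ext
      ext i
      fin_cases i
      · simp only [Fin.zero_eta]
        omega
      · simp only [Fin.mk_one]
        omega
    have hrange : Set.range φ ⊆ commonZeros (vecU n) := by
      rintro _ ⟨s, rfl⟩
      exact orthoFamily_chebU.mem_commonZeros.2 fun k hk =>
        evalAt_node_chebU hk (by omega) (by omega) (hlt s)
    calc (Module.finrank ℂ (polyLT n) : ℕ∞) = ENat.card ι := by
          rw [ENat.card_eq_coe_natCard, polyLT,
            Module.finrank_eq_nat_card_basis (basisRestrictSupport ℂ _)]
      _ ≤ (Set.range φ).encard := hinj.encard_range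
      _ ≤ (commonZeros (vecU n)).encard := Set.encard_le_encard hrange

end DeltoidChebyshev

theorem mainTheorem4 :
    -- the second kind
    ((∀ n : ℕ, DeltoidChebyshev.IsOrthonormalBasis (1 / 2) n (DeltoidChebyshev.vecU n)) ∧
      (∃ α β, DeltoidChebyshev.ThreeTerm DeltoidChebyshev.vecU α β) ∧
      (∀ α β, DeltoidChebyshev.ThreeTerm DeltoidChebyshev.vecU α β →
        ∀ n : ℕ, 1 ≤ n → DeltoidChebyshev.MaxZeroCond (α (n - 1))) ∧
      (∀ n : ℕ, 1 ≤ n → (DeltoidChebyshev.commonZeros (DeltoidChebyshev.vecU n)).encard =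
        (Module.finrank ℂ (DeltoidChebyshev.polyLT n) : ℕ∞))) ∧
    -- the first kind
    ((∀ n : ℕ, DeltoidChebyshev.IsOrthonormalBasis (-1 / 2) n (DeltoidChebyshev.vecT n)) ∧
      (∃ α β, DeltoidChebyshev.ThreeTerm DeltoidChebyshev.vecT α β) ∧
      (∀ α β, DeltoidChebyshev.ThreeTerm DeltoidChebyshev.vecT α β →
        ∀ n : ℕ, 2 ≤ n → ¬ DeltoidChebyshev.MaxZeroCond (α (n - 1))) ∧
      (∀ n : ℕ, 2 ≤ n → (DeltoidChebyshev.commonZeros (DeltoidChebyshev.vecT n)).encard <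
        (Module.finrank ℂ (DeltoidChebyshev.polyLT n) : ℕ∞))) := by
  refine ⟨⟨DeltoidChebyshev.orthoFamily_chebU.orthoSystem.isOrthonormalBasis,
    DeltoidChebyshev.orthoFamily_chebU.orthoSystem.exists_threeTerm,
    fun α β H n _ => DeltoidChebyshev.maxZeroCond_vecU H (n - 1),
    fun n _ => DeltoidChebyshev.encard_commonZeros_vecU n⟩,
    DeltoidChebyshev.orthoFamily_chebT.orthoSystem.isOrthonormalBasis,
    DeltoidChebyshev.orthoFamily_chebT.orthoSystem.exists_threeTerm, fun α β H n hn => ?_,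
    DeltoidChebyshev.encard_commonZeros_vecT_lt⟩
  obtain ⟨m, rfl⟩ : ∃ m, n = m + 2 := ⟨n - 2, by omega⟩
  exact DeltoidChebyshev.not_maxZeroCond_vecT H m
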